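/- Let $N\ge 1$ and let $\omega_1,\dots,\omega_N>0$ be non-resonant, i.e. $\sum_i m_i\omega_i=0$ with $m_i\in\mathbb Z$ only if all $m_i=0$. Consider the control system $\dot x=Ax+Bu$ in $\mathbb R^{2N}$, $x=(x_1,y_1,\dots,x_N,y_N)$, $|u|\le 1$, given by $$\dot x_i=y_i,\qquad \dot y_i=-\omega_i^2x_i+u,\qquad i=1,\dots,N,$$ so that $B=(0,1,\dots,0,1)$. An admissible control on $[0,T]$ is a measurable function $u$ with $|u(t)|\le 1$ for almost every $t$, and motions are absolutely continuous solutions. For $p=(\xi_1,\eta_1,\dots,\xi_N,\eta_N)$ put $z_i=(\eta_i^2+\omega_i^{-2}\xi_i^2)^{1/2}$ and $$H_\Omega(p)=\frac1{(2\pi)^N}\int_0^{2\pi}\!\!\cdots\int_0^{2\pi}\Big|\sum_{i=1}^N z_i\cos\varphi_i\Big|\,d\varphi_1\cdots d\varphi_N ,$$ let $\Omega=\{x:(x,p)\le H_\Omega(p)\ \text{for all }p\}$ be the convex body with support function $H_\Omega$, and let $\rho(x)=\inf\{r>0: x\in r\Omega\}$, so that $x\in\partial(\rho(x)\Omega)$.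 For $x\ne 0$ let $p(x)\neq 0$ be a solution $p$ of $\rho(x)^{-1}x=\frac{\partial H_\Omega}{\partial p}(p)$, i.e. an outer normal to $\rho(x)\Omega$ at $x$ (it is unique up to a positive factor). A motion under the feedback $u=-\operatorname{sign}(B,p(x))$ is a motion $x$ with an admissible control $u$ such that, for almost every $t$ with $x(t)\neq0$, $u(t)=-\operatorname{sign}(B,p(x(t)))$ if $(B,p(x(t)))\ne 0$, with no further condition on $u(t)\in[-1,1]$ if $(B,p(x(t)))=0$. Write $\rho(t)=\rho(x(t))$ and, for a motion on $[0,T]$, $M=\min\{\rho(0),\rho(T),T\}$. Then: 1. As $M\to+\infty$, motions under the feedback $u=-\operatorname{sign}(B,p(x))$ satisfy $(\rho(0)-\rho(T))/T=1+o(1)$; that is, for every $\varepsilon>0$ there is $M_0$, depending only on $\varepsilon$ and $\omega_1,\dots,\omega_N$, such that $|(\rho(0)-\rho(T))/T-1|\le\varepsilon$ for every such motion with $M\ge M_0$. 2. Under any admissible control, $(\rho(0)-\rho(T))/T\le 1+o(1)$ as $M\to+\infty$; that is, for every $\varepsilon>0$ there is $M_0$, depending only on $\varepsilon$ and $\omega_1,\dots,\omega_N$,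 such that $(\rho(0)-\rho(T))/T\le 1+\varepsilon$ for every motion with $M\ge M_0$. -/

import Mathlib

open MeasureTheory

noncomputable section

namespace Oscillators

/-- Phase space `ℝ^{2N}` with its Euclidean structure; the coordinate `(0, i)` is the position
`x_i` and `(1, i)` the velocity `y_i` of the `i`-th oscillator (dually, `ξ_i` and `η_i`). -/
abbrev Phase (N : ℕ) : Type := EuclideanSpace ℝ (Fin 2 × Fin N)

/-- The block diagonal matrix of the uncontrolled system. -/
def matA {N : ℕ} (ω : Fin N → ℝ) : Matrix (Fin 2 × Fin N) (Fin 2 × Fin N) ℝ :=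
  Matrix.blockDiagonal fun i => !![0, 1; -(ω i) ^ 2, 0]

/-- The vector `B = (0, 1, …, 0, 1)`. -/
def vecB (N : ℕ) : Phase N := WithLp.toLp 2 fun j => (![0, 1] : Fin 2 → ℝ) j.1

/-- There are no nontrivial integer relations between the frequencies. -/
def NonResonant {N : ℕ} (ω : Fin N → ℝ) : Prop :=
  ∀ m : Fin N → ℤ, ∑ i, (m i : ℝ) * ω i = 0 → m = 0

/-- `z_i = (η_i² + ω_i⁻² ξ_i²)^{1/2}`. -/
def amplitude {N : ℕ} (ω : Fin N → ℝ) (p : Phase N) (i : Fin N) : ℝ :=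
  Real.sqrt (p (1, i) ^ 2 + (ω i ^ 2)⁻¹ * p (0, i) ^ 2)

/-- The average of `|∑ z_i cos φ_i|` over the torus `[0, 2π]^N`. -/
def torusAverage {N : ℕ} (z : Fin N → ℝ) : ℝ :=
  ((2 * Real.pi) ^ N)⁻¹ *
    ∫ φ in Set.Icc (fun _ : Fin N => (0 : ℝ)) (fun _ => 2 * Real.pi),
      |∑ i, z i * Real.cos (φ i)|

/-- The support function of `Ω`. -/
def supportΩ {N : ℕ} (ω : Fin N → ℝ) (p : Phase N) : ℝ := torusAverage (amplitude ω p)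

/-- The closed convex set with support function `supportΩ`. -/
def bodyΩ {N : ℕ} (ω : Fin N → ℝ) : Set (Phase N) :=
  {x | ∀ p : Phase N, inner ℝ x p ≤ supportΩ ω p}

/-- The radial coordinate: `x = ρ(x) φ` with `φ ∈ ∂Ω`. -/
def rho {N : ℕ} (ω : Fin N → ℝ) (x : Phase N) : ℝ := gauge (bodyΩ ω) x

/-- `p` is a momentum at `x`, that is, a normal to `ρ(x) Ω` at `x`:
`ρ(x)⁻¹ x = ∂H_Ω/∂p (p)`. -/
def IsMomentum {N : ℕ} (ω : Fin N → ℝ) (x p : Phase N) : Prop :=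
  p ≠ 0 ∧ HasGradientAt (supportΩ ω) ((rho ω x)⁻¹ • x) p

/-- `x` is a (Carathéodory) solution on `[0, T]` of `x' = A x + B u`, where `u` is an admissible
control, that is, measurable with `|u| ≤ 1`. -/
structure IsMotion {N : ℕ} (ω : Fin N → ℝ) (T : ℝ) (x : ℝ → Phase N) (u : ℝ → ℝ) : Prop where
  aemeasurable : AEMeasurable u (volume.restrict (Set.Icc 0 T))
  abs_le_one : ∀ᵐ t ∂volume.restrict (Set.Icc 0 T), |u t| ≤ 1
  continuousOn : ContinuousOn x (Set.Icc 0 T)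
  eq_integral : ∀ t ∈ Set.Icc 0 T,
    x t = x 0 + ∫ s in (0 : ℝ)..t,
      (Matrix.toEuclideanCLM (𝕜 := ℝ) (matA ω) (x s) + u s • vecB N)

/-- A motion under the feedback `u = -sign (B, p(x))`. The feedback is discontinuous, so `sign 0`
is any number in `[-1, 1]`: on `(B, p(x)) = 0` the control is only required to be admissible,
which allows the singular (sliding) motions. -/
structure IsFeedbackMotion {N : ℕ} (ω : Fin N → ℝ) (T : ℝ) (x : ℝ → Phase N) (u : ℝ → ℝ) : Prop
    extends IsMotion ω T x u where
  feedback : ∀ᵐ t ∂volume.restrict (Set.Icc 0 T), ∀ p : Phase N, IsMomentum ω (x t) p →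
    inner ℝ (vecB N) p ≠ 0 → u t = -Real.sign (inner ℝ (vecB N) p)

end Oscillators

end

/-! Along a solution `p` of the adjoint system `p' = -Aᵀ p` one has `d/dt (x, p) = u (B, p)`. The
adjoint flow rotates each plane `(η_i, ξ_i/ω_i)`, so it preserves the amplitudes `z_i` and hence
`supportΩ`. By Weyl's theorem the time mean of `|(B, p)|` tends to `supportΩ p`, uniformly on the
compact set `supportΩ p = 1` (`exists_uniform_timeMean`). Duality with the gauge gives `(x, p) ≤
ρ(x) supportΩ p`, with equality for a norming `p`.

Upper bound (`exists_rho_sub_le`): transport the norming momentum of `x(0)` forward. No control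
lowers `(x, p)` by more than `∫ |(B, p)|`, about `T`, and `(x(T), p(T)) ≤ ρ(T)`.

Lower bound (`exists_feedback_decrease`): on a window `[a, b]` of bounded length transport the
norming momentum of `x(b)` backward. The feedback uses the norming momentum `q` of `x(s)` instead of
`p(s)`. For large `ρ` both nearly norm `x(s)`, so `supportΩ` is almost additive on them. By
`exists_wave_mul_pos` this forces `(B, q)` and `(B, p(s))` to have the same sign unless `(B, p(s))`
is small, so the feedback is almost optimal for `p`. Chaining windows backward from `T` gives the
bound on all of `[0, T]`.

The sign statement is a rigidity property: equality in the triangle inequality for `supportΩ` makes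
two waves agree in sign on the whole torus cube, and a nonzero wave has no zero that is a local
extremum. -/

noncomputable section

namespace Oscillators

open Filter Topology

variable {N : ℕ}

/-! ### Equidistribution of linear flows on the torus. -/

section Equidistribution

open Complex

/-- The covering map `ℝ^N → (ℝ/ℤ)^N` that identifies angles modulo `2π`. -/
def toTorus (φ : Fin N → ℝ) : UnitAddTorus (Fin N) :=
  fun i => ((φ i / (2 * Real.pi) : ℝ) : UnitAddCircle)

lemma continuous_toTorus : Continuous (toTorus : (Fin N → ℝ) → UnitAddTorus (Fin N)) := by
  refine continuous_pi fun i => ?_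
  exact (AddCircle.continuous_mk' 1).comp ((continuous_apply i).div_const _)

lemma fourier_toTorus (n : ℤ) (φ : Fin N → ℝ) (i : Fin N) :
    fourier n (toTorus φ i) = cexp (n * φ i * I) := by
  have hpi : (Real.pi : ℂ) ≠ 0 := by exact_mod_cast Real.pi_ne_zero
  rw [toTorus, fourier_coe_apply]
  congr 1
  push_cast
  field_simp

lemma mFourier_toTorus (n : Fin N → ℤ) (φ : Fin N → ℝ) :
    UnitAddTorus.mFourier n (toTorus φ) = ∏ i, cexp (n i * φ i * I) := by
  simp only [UnitAddTorus.mFourier, ContinuousMap.coe_mk, fourier_toTorus]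

/-- The cube `[0, 2π]^N`. -/
abbrev box (N : ℕ) : Set (Fin N → ℝ) := Set.Icc (fun _ => (0 : ℝ)) (fun _ => 2 * Real.pi)

lemma volume_real_box : (volume : Measure (Fin N → ℝ)).real (box N) = (2 * Real.pi) ^ N := by
  rw [Measure.real, Real.volume_Icc_pi_toReal]
  · simp
  · intro i; positivity

lemma integrableOn_box {E : Type*} [NormedAddCommGroup E] {f : (Fin N → ℝ) → E}
    (hf : Continuous f) : IntegrableOn f (box N) :=
  hf.continuousOn.integrableOn_compact isCompact_Icc

/-- The mean value of a function over the cube `[0, 2π]^N`. -/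
def boxMean {E : Type*} [NormedAddCommGroup E] [NormedSpace ℝ E] (f : (Fin N → ℝ) → E) : E :=
  ((2 * Real.pi) ^ N)⁻¹ • ∫ φ in box N, f φ

lemma norm_boxMean_le {E : Type*} [NormedAddCommGroup E] [NormedSpace ℝ E]
    {f : (Fin N → ℝ) → E} {C : ℝ} (hf : ∀ φ, ‖f φ‖ ≤ C) : ‖boxMean f‖ ≤ C := by
  have h : ‖∫ φ in box N, f φ‖ ≤ C * (volume : Measure (Fin N → ℝ)).real (box N) :=
    norm_setIntegral_le_of_norm_le_const isCompact_Icc.measure_lt_top fun φ _ => hf φ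
  rw [volume_real_box] at h
  have hp : (0 : ℝ) < (2 * Real.pi) ^ N := by positivity
  rw [boxMean, norm_smul, norm_inv, Real.norm_of_nonneg hp.le, inv_mul_le_iff₀ hp]
  linarith

lemma boxMean_sub {E : Type*} [NormedAddCommGroup E] [NormedSpace ℝ E]
    {f g : (Fin N → ℝ) → E} (hf : Continuous f) (hg : Continuous g) :
    boxMean (fun φ => f φ - g φ) = boxMean f - boxMean g := by
  rw [boxMean, integral_sub (integrableOn_box hf) (integrableOn_box hg), smul_sub]
  rfl

lemma boxMean_add {E : Type*} [NormedAddCommGroup E] [NormedSpace ℝ E]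
    {f g : (Fin N → ℝ) → E} (hf : Continuous f) (hg : Continuous g) :
    boxMean (fun φ => f φ + g φ) = boxMean f + boxMean g := by
  rw [boxMean, integral_add (integrableOn_box hf) (integrableOn_box hg), smul_add]
  rfl

lemma boxMean_mFourier (n : Fin N → ℤ) :
    boxMean (fun φ => UnitAddTorus.mFourier n (toTorus φ)) = if n = 0 then 1 else 0 := by
  have hbox : (volume : Measure (Fin N → ℝ)).restrict (box N) =
      Measure.pi fun _ : Fin N => volume.restrict (Set.Icc (0 : ℝ) (2 * Real.pi)) := by
    rw [box, ← Set.pi_univ_Icc, volume_pi, Measure.restrict_pi_pi]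
  have key : ∀ k : ℤ, k ≠ 0 → ∫ s in Set.Icc (0 : ℝ) (2 * Real.pi), cexp (k * s * I) = 0 := by
    intro k hk
    have hk' : (k : ℂ) * I ≠ 0 := mul_ne_zero (by exact_mod_cast hk) I_ne_zero
    rw [integral_Icc_eq_integral_Ioc, ← intervalIntegral.integral_of_le (by positivity)]
    simp_rw [mul_right_comm _ _ I]
    rw [integral_exp_mul_complex hk']
    have : cexp (↑k * I * ↑(2 * Real.pi)) = 1 := by
      rw [Complex.exp_eq_one_iff]
      exact ⟨k, by push_cast; ring⟩
    rw [this]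
    simp
  simp_rw [boxMean, mFourier_toTorus, hbox]
  rw [integral_fintype_prod_eq_prod (fun i (s : ℝ) => cexp (n i * s * I))]
  split_ifs with h
  · subst h
    simp [measureReal_def, Complex.real_smul, ENNReal.toReal_ofReal Real.pi_pos.le]
  · obtain ⟨i, hi⟩ := Function.ne_iff.1 h
    rw [Finset.prod_eq_zero (Finset.mem_univ i) (key _ hi), smul_zero]

/-- The mean of `f` over the time interval `[0, T]`. -/
def timeMean {E : Type*} [NormedAddCommGroup E] [NormedSpace ℝ E] (f : ℝ → E) (T : ℝ) : E :=
  T⁻¹ • ∫ t in (0 : ℝ)..T, f t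

lemma norm_timeMean_le {E : Type*} [NormedAddCommGroup E] [NormedSpace ℝ E]
    {f : ℝ → E} {C T : ℝ} (hT : 0 < T) (hf : ∀ t, ‖f t‖ ≤ C) : ‖timeMean f T‖ ≤ C := by
  have h := intervalIntegral.norm_integral_le_of_norm_le_const (a := 0) (b := T)
    (f := f) fun t _ => hf t
  rw [sub_zero, abs_of_pos hT] at h
  rw [timeMean, norm_smul, norm_inv, Real.norm_of_nonneg hT.le, inv_mul_le_iff₀ hT]
  linarith

lemma timeMean_sub {E : Type*} [NormedAddCommGroup E] [NormedSpace ℝ E]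
    {f g : ℝ → E} (hf : Continuous f) (hg : Continuous g) (T : ℝ) :
    timeMean (fun t => f t - g t) T = timeMean f T - timeMean g T := by
  rw [timeMean, intervalIntegral.integral_sub (hf.intervalIntegrable _ _)
    (hg.intervalIntegrable _ _), smul_sub]
  rfl

lemma timeMean_add {E : Type*} [NormedAddCommGroup E] [NormedSpace ℝ E]
    {f g : ℝ → E} (hf : Continuous f) (hg : Continuous g) (T : ℝ) :
    timeMean (fun t => f t + g t) T = timeMean f T + timeMean g T := by
  rw [timeMean, intervalIntegral.integral_add (hf.intervalIntegrable _ _)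
    (hg.intervalIntegrable _ _), smul_add]
  rfl

lemma tendsto_timeMean_exp {c : ℝ} (hc : c ≠ 0) :
    Tendsto (timeMean fun t => cexp (c * I * t)) atTop (𝓝 0) := by
  have hc' : (c : ℂ) * I ≠ 0 := mul_ne_zero (by exact_mod_cast hc) I_ne_zero
  refine squeeze_zero_norm' (a := fun T : ℝ => T⁻¹ * (2 / |c|)) ?_ ?_
  · filter_upwards [eventually_gt_atTop 0] with T hT
    rw [timeMean, integral_exp_mul_complex hc', norm_smul, norm_inv, Real.norm_of_nonneg hT.le,
      norm_div]
    have h1 : ‖(c : ℂ) * I‖ = |c| := by simp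
    have h2 : ‖cexp (c * I * T) - cexp (c * I * (0 : ℝ))‖ ≤ 2 := by
      refine (norm_sub_le _ _).trans ?_
      have e1 : (c : ℂ) * I * T = ((c * T : ℝ) : ℂ) * I := by push_cast; ring
      rw [e1, Complex.norm_exp_ofReal_mul_I]
      norm_num
    rw [h1]
    gcongr
  · simpa using tendsto_inv_atTop_zero.mul_const (2 / |c|)

/-- Along the line the character `n` is a pure exponential of frequency `∑ n_i ω_i`, nonzero for `n
≠ 0`. All later uses of nonresonance come down to this fact. -/
lemma tendsto_timeMean_mFourier {ω : Fin N → ℝ} (hω : NonResonant ω) (α : Fin N → ℝ)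
    (n : Fin N → ℤ) :
    Tendsto (timeMean fun t => UnitAddTorus.mFourier n (toTorus fun i => α i + t * ω i)) atTop
      (𝓝 (boxMean fun φ => UnitAddTorus.mFourier n (toTorus φ))) := by
  rw [boxMean_mFourier]
  have e : ∀ t : ℝ, UnitAddTorus.mFourier n (toTorus fun i => α i + t * ω i) =
      (∏ i, cexp (n i * α i * I)) * cexp ((∑ i, (n i : ℝ) * ω i : ℝ) * I * t) := by
    intro t
    rw [mFourier_toTorus, Complex.ofReal_sum, Finset.sum_mul, Finset.sum_mul, Complex.exp_sum,
      ← Finset.prod_mul_distrib]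
    refine Finset.prod_congr rfl fun i _ => ?_
    rw [← Complex.exp_add]
    congr 1
    push_cast
    ring
  split_ifs with h
  · subst h
    refine tendsto_const_nhds.congr' ?_
    filter_upwards [eventually_gt_atTop 0] with T hT
    simp [timeMean, UnitAddTorus.mFourier_zero, hT.ne']
  · have h' : (∑ i, (n i : ℝ) * ω i) ≠ 0 := fun h0 => h (hω n h0)
    have := (tendsto_timeMean_exp h').const_mul (∏ i, cexp (n i * α i * I))
    rw [mul_zero] at this
    refine this.congr fun T => ?_
    simp_rw [timeMean, e, intervalIntegral.integral_const_mul, mul_smul_comm]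

/-- Weyl's equidistribution theorem for the linear flow with nonresonant frequencies. -/
theorem tendsto_timeMean_torus {ω : Fin N → ℝ} (hω : NonResonant ω) (α : Fin N → ℝ)
    (F : C(UnitAddTorus (Fin N), ℂ)) :
    Tendsto (timeMean fun t => F (toTorus fun i => α i + t * ω i)) atTop
      (𝓝 (boxMean fun φ => F (toTorus φ))) := by
  have hline : Continuous fun t : ℝ => toTorus fun i => α i + t * ω i :=
    continuous_toTorus.comp (by fun_prop)
  have hspan : ∀ P ∈ Submodule.span ℂ (Set.range (UnitAddTorus.mFourier (d := Fin N))),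
      Tendsto (timeMean fun t => P (toTorus fun i => α i + t * ω i)) atTop
      (𝓝 (boxMean fun φ => P (toTorus φ))) := by
    intro P hP
    induction hP using Submodule.span_induction with
    | mem P hP =>
      obtain ⟨n, rfl⟩ := hP
      exact tendsto_timeMean_mFourier hω α n
    | zero =>
      have h0 : timeMean (fun _ : ℝ => (0 : ℂ)) = fun _ => 0 := by funext; simp [timeMean]
      simp [h0, boxMean]
    | add P Q _ _ hP hQ =>
      have := hP.add hQ
      rw [← boxMean_add (f := fun φ => P (toTorus φ)) (g := fun φ => Q (toTorus φ))
        (P.continuous.comp continuous_toTorus) (Q.continuous.comp continuous_toTorus)] at this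
      exact this.congr fun T => (timeMean_add (P.continuous.comp hline)
        (Q.continuous.comp hline) T).symm
    | smul a P _ hP =>
      have := hP.const_smul a
      convert this using 2
      · simp [timeMean, mul_left_comm]
      · simp [boxMean, integral_const_mul, mul_left_comm]
  -- Trigonometric polynomials are uniformly dense, and both means are contractions for the sup
  -- norm, so an `ε/3` argument suffices.
  have hF : F ∈ closure (Submodule.span ℂ (Set.range (UnitAddTorus.mFourier (d := Fin N))) :
      Set C(UnitAddTorus (Fin N), ℂ)) := by
    rw [← Submodule.topologicalClosure_coe, UnitAddTorus.span_mFourier_closure_eq_top]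
    trivial
  rw [Metric.tendsto_nhds]
  intro ε hε
  obtain ⟨P, hP, hFP⟩ := Metric.mem_closure_iff.1 hF (ε / 3) (by positivity)
  have hle : ∀ x, ‖F x - P x‖ ≤ dist F P := fun x => by
    rw [← dist_eq_norm]; exact ContinuousMap.dist_apply_le_dist x
  filter_upwards [Metric.tendsto_nhds.1 (hspan P hP) (ε / 3) (by positivity),
    eventually_gt_atTop 0] with T hT hT0
  have h1 := norm_timeMean_le hT0 fun t => hle (toTorus fun i => α i + t * ω i)
  have h2 := norm_boxMean_le fun φ : Fin N → ℝ => hle (toTorus φ)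
  rw [timeMean_sub (f := fun t : ℝ => F (toTorus fun i => α i + t * ω i))
    (g := fun t : ℝ => P (toTorus fun i => α i + t * ω i)) (F.continuous.comp hline)
    (P.continuous.comp hline), ← dist_eq_norm] at h1
  rw [boxMean_sub (f := fun φ => F (toTorus φ)) (g := fun φ => P (toTorus φ))
    (F.continuous.comp continuous_toTorus) (P.continuous.comp continuous_toTorus),
    ← dist_eq_norm] at h2
  calc _ ≤ _ := dist_triangle4_right _ _ _ _
    _ < _ := by linarith

lemma boxMean_ofReal (f : (Fin N → ℝ) → ℝ) :
    boxMean (fun φ => (f φ : ℂ)) = (boxMean f : ℝ) := by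
  rw [boxMean, integral_complex_ofReal, boxMean, Complex.real_smul, smul_eq_mul, Complex.ofReal_mul]

lemma timeMean_ofReal (f : ℝ → ℝ) (T : ℝ) :
    timeMean (fun t => (f t : ℂ)) T = (timeMean f T : ℝ) := by
  rw [timeMean, intervalIntegral.integral_ofReal, timeMean, Complex.real_smul, smul_eq_mul,
    Complex.ofReal_mul]

/-- The time mean of the modulus of a quasiperiodic sum equals its phase mean. -/
theorem tendsto_timeMean_abs_sum {ω : Fin N → ℝ} (hω : NonResonant ω) (α c d : Fin N → ℝ) :
    Tendsto (timeMean fun t =>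
      |∑ i, (c i * Real.cos (α i + t * ω i) + d i * Real.sin (α i + t * ω i))|) atTop
      (𝓝 (boxMean fun φ => |∑ i, (c i * Real.cos (φ i) + d i * Real.sin (φ i))|)) := by
  let F : C(UnitAddTorus (Fin N), ℂ) :=
    ⟨fun x => ((|∑ i, (c i * (fourier 1 (x i) : ℂ).re + d i * (fourier 1 (x i) : ℂ).im)| : ℝ) : ℂ),
      by fun_prop⟩
  have hF : ∀ φ, F (toTorus φ) =
      ((|∑ i, (c i * Real.cos (φ i) + d i * Real.sin (φ i))| : ℝ) : ℂ) := by
    intro φ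
    simp only [F, ContinuousMap.coe_mk, fourier_toTorus, Int.cast_one, one_mul,
      Complex.exp_ofReal_mul_I_re, Complex.exp_ofReal_mul_I_im]
  have h := (Complex.continuous_re.tendsto _).comp (tendsto_timeMean_torus hω α F)
  simp_rw [hF, boxMean_ofReal, Complex.ofReal_re] at h
  refine h.congr fun T => ?_
  rw [Function.comp_apply, timeMean_ofReal, Complex.ofReal_re]

end Equidistribution

/-! ### Waves, and the support function as their phase mean. -/

/-- The vector dual to the phase `φ`: pairing it with a momentum `p` gives the value of the
observable `(B, p)` after the `i`-th oscillator has turned by the angle `φ i`. -/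
def waveVec (ω φ : Fin N → ℝ) : Phase N :=
  WithLp.toLp 2 fun j => (![-(Real.sin (φ j.2) / ω j.2), Real.cos (φ j.2)] : Fin 2 → ℝ) j.1

/-- The observable `(B, p)` as a function of the phases. -/
def wave (ω : Fin N → ℝ) (p : Phase N) (φ : Fin N → ℝ) : ℝ := inner ℝ (waveVec ω φ) p

lemma inner_phase (x p : Phase N) :
    inner ℝ x p = ∑ i, (x (0, i) * p (0, i) + x (1, i) * p (1, i)) := by
  simp only [PiLp.inner_apply, Fintype.sum_prod_type, Fin.sum_univ_two,
    ← Finset.sum_add_distrib]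
  simp [mul_comm]

lemma wave_eq_sum (ω : Fin N → ℝ) (p : Phase N) (φ : Fin N → ℝ) :
    wave ω p φ =
      ∑ i, (p (1, i) * Real.cos (φ i) + -(p (0, i) / ω i) * Real.sin (φ i)) := by
  rw [wave, inner_phase]
  refine Finset.sum_congr rfl fun i _ => ?_
  simp [waveVec]
  ring

lemma continuous_waveVec (ω : Fin N → ℝ) : Continuous (waveVec ω) := by
  refine (PiLp.continuous_toLp 2 _).comp (continuous_pi fun j => ?_)
  obtain ⟨k, i⟩ := j
  fin_cases k <;> simp <;> fun_prop

@[fun_prop]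
lemma continuous_wave (ω : Fin N → ℝ) (p : Phase N) : Continuous (wave ω p) :=
  (continuous_waveVec ω).inner continuous_const

@[fun_prop]
lemma continuous_wave_left (ω φ : Fin N → ℝ) : Continuous fun p => wave ω p φ :=
  continuous_const.inner continuous_id

lemma wave_add (ω : Fin N → ℝ) (p q : Phase N) (φ : Fin N → ℝ) :
    wave ω (p + q) φ = wave ω p φ + wave ω q φ := inner_add_right _ _ _

lemma wave_sub (ω : Fin N → ℝ) (p q : Phase N) (φ : Fin N → ℝ) :
    wave ω (p - q) φ = wave ω p φ - wave ω q φ := inner_sub_right _ _ _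

lemma wave_neg (ω : Fin N → ℝ) (p : Phase N) (φ : Fin N → ℝ) :
    wave ω (-p) φ = -wave ω p φ := inner_neg_right _ _

lemma wave_smul (ω : Fin N → ℝ) (r : ℝ) (p : Phase N) (φ : Fin N → ℝ) :
    wave ω (r • p) φ = r * wave ω p φ := real_inner_smul_right _ _ _

lemma exists_norm_waveVec_le (ω : Fin N → ℝ) : ∃ C, 0 ≤ C ∧ ∀ φ, ‖waveVec ω φ‖ ≤ C := by
  refine ⟨Real.sqrt (∑ i, ((ω i)⁻¹ ^ 2 + 1)), Real.sqrt_nonneg _, fun φ => ?_⟩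
  refine Real.le_sqrt_of_sq_le ?_
  rw [← real_inner_self_eq_norm_sq, inner_phase]
  refine Finset.sum_le_sum fun i _ => ?_
  have h1 := Real.sin_sq_le_one (φ i)
  have h2 := Real.cos_sq_le_one (φ i)
  simp only [waveVec, Matrix.cons_val_zero, Matrix.cons_val_one]
  have : (ω i)⁻¹ ^ 2 * Real.sin (φ i) ^ 2 ≤ (ω i)⁻¹ ^ 2 * 1 := by gcongr
  calc _ = (ω i)⁻¹ ^ 2 * Real.sin (φ i) ^ 2 + Real.cos (φ i) ^ 2 := by ring
    _ ≤ _ := by linarith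

lemma exists_abs_wave_le (ω : Fin N → ℝ) : ∃ C, 0 ≤ C ∧ ∀ p φ, |wave ω p φ| ≤ C * ‖p‖ := by
  obtain ⟨C, hC, h⟩ := exists_norm_waveVec_le ω
  exact ⟨C, hC, fun p φ => (abs_real_inner_le_norm _ _).trans
    (mul_le_mul_of_nonneg_right (h φ) (norm_nonneg _))⟩

lemma tendsto_timeMean_wave {ω : Fin N → ℝ} (hω : NonResonant ω) (p : Phase N) :
    Tendsto (timeMean fun t => |wave ω p fun i => t * ω i|) atTop
      (𝓝 (boxMean fun φ => |wave ω p φ|)) := by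
  have := tendsto_timeMean_abs_sum hω 0 (fun i => p (1, i)) (fun i => -(p (0, i) / ω i))
  simpa only [wave_eq_sum, Pi.zero_apply, zero_add] using this

/-- The support function is the phase mean of `|(B, p)|`. -/
theorem supportΩ_eq_boxMean {ω : Fin N → ℝ} (hω : NonResonant ω) (p : Phase N) :
    supportΩ ω p = boxMean fun φ => |wave ω p φ| := by
  let w : Fin N → ℂ := fun i => ⟨p (1, i), p (0, i) / ω i⟩
  have hamp : ∀ i, amplitude ω p i = ‖w i‖ := fun i => by
    rw [Complex.norm_eq_sqrt_sq_add_sq, amplitude]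
    congr 1
    simp only [w, div_pow]
    ring
  -- The amplitude-phase form started at the phases `arg w_i` and the wave started at `0` are the
  -- same function of time. Uniqueness of the limit identifies their phase means, with no change of
  -- variables on the cube.
  have h1 := tendsto_timeMean_abs_sum hω (fun i => (w i).arg) (amplitude ω p) 0
  have h2 := tendsto_timeMean_wave hω p
  have e : (fun t : ℝ => |wave ω p fun i => t * ω i|) = fun t =>
      |∑ i, (amplitude ω p i * Real.cos ((w i).arg + t * ω i) +
        (0 : Fin N → ℝ) i * Real.sin ((w i).arg + t * ω i))| := by
    funext t
    rw [wave_eq_sum]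
    congr 1
    refine Finset.sum_congr rfl fun i _ => ?_
    have hc : amplitude ω p i * Real.cos (w i).arg = p (1, i) := by
      rw [hamp, Complex.norm_mul_cos_arg]
    have hs : amplitude ω p i * Real.sin (w i).arg = p (0, i) / ω i := by
      rw [hamp, Complex.norm_mul_sin_arg]
    rw [Real.cos_add, ← hc, ← hs, Pi.zero_apply]
    ring
  rw [e] at h2
  rw [← tendsto_nhds_unique h1 h2]
  simp [supportΩ, torusAverage, boxMean]

lemma boxMean_mono {f g : (Fin N → ℝ) → ℝ} (hf : Continuous f) (hg : Continuous g)
    (h : ∀ φ, f φ ≤ g φ) : boxMean f ≤ boxMean g := by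
  refine mul_le_mul_of_nonneg_left ?_ (by positivity)
  exact integral_mono (integrableOn_box hf) (integrableOn_box hg) h

lemma supportΩ_smul {ω : Fin N → ℝ} (hω : NonResonant ω) {r : ℝ} (hr : 0 ≤ r) (p : Phase N) :
    supportΩ ω (r • p) = r * supportΩ ω p := by
  simp_rw [supportΩ_eq_boxMean hω, wave_smul, abs_mul, abs_of_nonneg hr, boxMean,
    integral_const_mul, smul_eq_mul]
  ring

lemma supportΩ_add_le {ω : Fin N → ℝ} (hω : NonResonant ω) (p q : Phase N) :
    supportΩ ω (p + q) ≤ supportΩ ω p + supportΩ ω q := by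
  simp_rw [supportΩ_eq_boxMean hω, wave_add]
  rw [← boxMean_add (by fun_prop) (by fun_prop)]
  exact boxMean_mono (by fun_prop) (by fun_prop) fun φ => abs_add_le _ _

lemma exists_abs_supportΩ_sub_le {ω : Fin N → ℝ} (hω : NonResonant ω) :
    ∃ C, 0 ≤ C ∧ ∀ p q, |supportΩ ω p - supportΩ ω q| ≤ C * ‖p - q‖ := by
  obtain ⟨C, hC, h⟩ := exists_abs_wave_le ω
  refine ⟨C, hC, fun p q => ?_⟩
  simp_rw [supportΩ_eq_boxMean hω]
  rw [← boxMean_sub (by fun_prop) (by fun_prop), ← Real.norm_eq_abs]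
  refine norm_boxMean_le fun φ => ?_
  rw [Real.norm_eq_abs]
  refine (abs_abs_sub_abs_le _ _).trans ?_
  rw [← wave_sub]
  exact h _ _

lemma continuous_supportΩ {ω : Fin N → ℝ} (hω : NonResonant ω) : Continuous (supportΩ ω) := by
  obtain ⟨C, hC, h⟩ := exists_abs_supportΩ_sub_le hω
  exact (LipschitzWith.of_dist_le_mul (K := ⟨C, hC⟩) fun p q => by
    rw [Real.dist_eq, dist_eq_norm]; exact h p q).continuous

/-! ### Zeros of waves, positivity of the support function and sign rigidity. -/

/-- A nonnegative continuous function on the cube with zero mean vanishes near its centre. -/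
lemma eventually_eq_zero_of_boxMean_eq_zero {f : (Fin N → ℝ) → ℝ} (hf : Continuous f)
    (h0 : ∀ φ, 0 ≤ f φ) (h : boxMean f = 0) : ∀ᶠ φ in 𝓝 (fun _ : Fin N => Real.pi), f φ = 0 := by
  have hp : (0 : ℝ) < (2 * Real.pi) ^ N := by positivity
  have h1 : ∫ φ in box N, f φ = 0 := by
    rw [boxMean, smul_eq_mul] at h
    exact (mul_eq_zero.1 h).resolve_left (inv_ne_zero hp.ne')
  rw [setIntegral_eq_zero_iff_of_nonneg_ae (Eventually.of_forall h0) (integrableOn_box hf)] at h1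
  have h2 : Set.EqOn f 0 (interior (box N)) :=
    Measure.eqOn_open_of_ae_eq (ae_restrict_of_ae_restrict_of_subset interior_subset h1)
      isOpen_interior hf.continuousOn continuousOn_const
  have hbox : box N ∈ 𝓝 (fun _ : Fin N => Real.pi) :=
    pi_Icc_mem_nhds (fun _ => Real.pi_pos) (fun _ => by linarith [Real.pi_pos])
  filter_upwards [interior_mem_nhds.2 hbox] with φ hφ using h2 hφ

/-- The phase `0`, where the wave is `(B, p)`, is a vertex of the cube. This moves sign information
to an interior point, where vanishing of a mean controls a full neighbourhood. -/
lemma wave_center (ω : Fin N → ℝ) (p : Phase N) :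
    wave ω p (fun _ => Real.pi) = -wave ω p 0 := by
  simp [wave_eq_sum]

lemma wave_update (ω : Fin N → ℝ) (p : Phase N) (φ : Fin N → ℝ) (i : Fin N) (t : ℝ) :
    wave ω p (Function.update φ i t) = wave ω p φ +
      (p (1, i) * Real.cos t - p (0, i) / ω i * Real.sin t -
        (p (1, i) * Real.cos (φ i) - p (0, i) / ω i * Real.sin (φ i))) := by
  rw [← sub_eq_iff_eq_add', wave_eq_sum, wave_eq_sum, ← Finset.sum_sub_distrib,
    Finset.sum_eq_single i]
  · simp; ring
  · intro j _ hj
    simp [hj]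
  · simp

/-- If `a (cos t - 1) + b sin t` has a local minimum at `0`, then `b = 0` and `a ≤ 0`. -/
lemma eq_zero_and_nonpos_of_trig_nonneg {a b : ℝ}
    (h : ∀ᶠ t in 𝓝 (0 : ℝ), 0 ≤ a * (Real.cos t - 1) + b * Real.sin t) : b = 0 ∧ a ≤ 0 := by
  have hb : b = 0 := by
    have hd : HasDerivAt (fun t => a * (Real.cos t - 1) + b * Real.sin t)
        (a * (-Real.sin 0) + b * Real.cos 0) 0 :=
      (((Real.hasDerivAt_cos 0).sub_const 1).const_mul a).add
        ((Real.hasDerivAt_sin 0).const_mul b)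
    have hm : IsLocalMin (fun t => a * (Real.cos t - 1) + b * Real.sin t) 0 := by
      filter_upwards [h] with t ht
      simpa using ht
    simpa using hm.hasDerivAt_eq_zero hd
  refine ⟨hb, ?_⟩
  subst hb
  obtain ⟨ε, hε, h⟩ := Metric.eventually_nhds_iff.1 h
  have hm : 0 < min (ε / 2) 1 := by positivity
  have hlt : min (ε / 2) 1 < ε := (min_le_left _ _).trans_lt (by linarith)
  have h1 := h (y := min (ε / 2) 1) (by rwa [Real.dist_eq, sub_zero, abs_of_pos hm])
  have h2 : Real.cos (min (ε / 2) 1) < 1 := by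
    have := Real.cos_lt_cos_of_nonneg_of_le_pi le_rfl
      ((min_le_right (ε / 2) 1).trans (by linarith [Real.pi_gt_three])) hm
    rwa [Real.cos_zero] at this
  by_contra hc
  push Not at hc
  nlinarith

/-- A nonzero wave cannot have a zero that is a local minimum. -/
theorem eq_zero_of_wave_nonneg {ω : Fin N → ℝ} (hpos : ∀ i, 0 < ω i) {p : Phase N}
    {φ : Fin N → ℝ} (h0 : wave ω p φ = 0) (h : ∀ᶠ ψ in 𝓝 φ, 0 ≤ wave ω p ψ) : p = 0 := by
  -- Vary one phase at a time: the slope in `φ_i` vanishes and the `i`-th summand of the wave, minus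
  -- its own second derivative, is nonpositive.
  have key : ∀ i, p (1, i) * -Real.sin (φ i) - p (0, i) / ω i * Real.cos (φ i) = 0 ∧
      p (1, i) * Real.cos (φ i) - p (0, i) / ω i * Real.sin (φ i) ≤ 0 := by
    intro i
    refine eq_zero_and_nonpos_of_trig_nonneg ?_
    have hc : Tendsto (fun t : ℝ => Function.update φ i (φ i + t)) (𝓝 0) (𝓝 φ) := by
      have : Continuous fun t : ℝ => Function.update φ i (φ i + t) := by fun_prop
      simpa using this.tendsto 0
    filter_upwards [hc.eventually h] with t ht
    rw [wave_update, h0, Real.cos_add, Real.sin_add] at ht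
    linarith
  have hsum : ∑ i, (p (1, i) * Real.cos (φ i) - p (0, i) / ω i * Real.sin (φ i)) = 0 := by
    rw [← h0, wave_eq_sum]
    exact Finset.sum_congr rfl fun i _ => by ring
  -- Nonpositive summands with sum `0` all vanish. Each summand then vanishes together with its
  -- slope, which kills both coefficients.
  have hz := (Finset.sum_eq_zero_iff_of_nonpos fun i _ => (key i).2).1 hsum
  have hcomp : ∀ i, p (1, i) = 0 ∧ p (0, i) / ω i = 0 := fun i => by
    have h1 := (key i).1
    have h2 := hz i (Finset.mem_univ i)
    have h3 := Real.sin_sq_add_cos_sq (φ i)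
    constructor
    · linear_combination Real.cos (φ i) * h2 - Real.sin (φ i) * h1 - p (1, i) * h3
    · linear_combination -Real.sin (φ i) * h2 - Real.cos (φ i) * h1 - p (0, i) / ω i * h3
  ext ⟨k, i⟩
  fin_cases k
  · simpa [(hpos i).ne'] using (hcomp i).2
  · simpa using (hcomp i).1

theorem supportΩ_nonneg {ω : Fin N → ℝ} (p : Phase N) : 0 ≤ supportΩ ω p := by
  unfold supportΩ torusAverage
  positivity

theorem supportΩ_pos {ω : Fin N → ℝ} (hpos : ∀ i, 0 < ω i) (hω : NonResonant ω) {p : Phase N}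
    (hp : p ≠ 0) : 0 < supportΩ ω p := by
  refine (supportΩ_nonneg p).lt_of_ne' fun h => hp ?_
  rw [supportΩ_eq_boxMean hω] at h
  have h := eventually_eq_zero_of_boxMean_eq_zero (by fun_prop) (fun φ => abs_nonneg _) h
  refine eq_zero_of_wave_nonneg hpos (abs_eq_zero.1 h.self_of_nhds) ?_
  filter_upwards [h] with φ hφ using (abs_eq_zero.1 hφ).ge

/-- If the support function is additive on `p`, `q`, then `(B, p)` and `(B, q)` have the same
sign. -/
theorem wave_mul_pos_of_supportΩ_add {ω : Fin N → ℝ} (hpos : ∀ i, 0 < ω i) (hω : NonResonant ω)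
    {p q : Phase N} (hp : p ≠ 0) (h : supportΩ ω (p + q) = supportΩ ω p + supportΩ ω q)
    (hq : wave ω q 0 ≠ 0) : 0 < wave ω p 0 * wave ω q 0 := by
  -- The defect in the pointwise triangle inequality is nonnegative, continuous and of zero mean.
  have hz : boxMean (fun φ => |wave ω p φ| + |wave ω q φ| - |wave ω (p + q) φ|) = 0 := by
    rw [boxMean_sub (by fun_prop) (by fun_prop), boxMean_add (by fun_prop) (by fun_prop),
      ← supportΩ_eq_boxMean hω, ← supportΩ_eq_boxMean hω, ← supportΩ_eq_boxMean hω, h, sub_self]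
  have hev := eventually_eq_zero_of_boxMean_eq_zero (by fun_prop) (fun φ => by
    rw [wave_add]; linarith [abs_add_le (wave ω p φ) (wave ω q φ)]) hz
  have hsame : ∀ᶠ φ in 𝓝 (fun _ : Fin N => Real.pi), 0 ≤ wave ω p φ * wave ω q φ := by
    filter_upwards [hev] with φ hφ
    rw [wave_add] at hφ
    have := (abs_add_eq_add_abs_iff (wave ω p φ) (wave ω q φ)).1 (by linarith)
    rcases this with h | h
    · exact mul_nonneg h.1 h.2
    · exact mul_nonneg_of_nonpos_of_nonpos h.1 h.2
  have hcp := wave_center ω p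
  have hcq := wave_center ω q
  have hcont := (continuous_wave ω q).tendsto (fun _ : Fin N => Real.pi)
  -- Near the centre the wave of `q` keeps a strict sign, so a zero of the wave of `p` there would
  -- be a local minimum of it or of its negative.
  have hne : wave ω p (fun _ => Real.pi) ≠ 0 := by
    intro h0
    rcases lt_or_gt_of_ne hq with hlt | hgt
    · refine hp (eq_zero_of_wave_nonneg hpos h0 ?_)
      filter_upwards [hsame, hcont.eventually (lt_mem_nhds (a := 0) (by linarith))] with φ h1 h2
      exact nonneg_of_mul_nonneg_left h1 h2
    · refine hp (neg_eq_zero.1 (eq_zero_of_wave_nonneg hpos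
        (φ := fun _ => Real.pi) (by rw [wave_neg, h0, neg_zero]) ?_))
      filter_upwards [hsame, hcont.eventually
        (gt_mem_nhds (show _ < (0 : ℝ) by linarith))] with φ h1 h2
      rw [wave_neg]
      nlinarith
  have h1 := hsame.self_of_nhds
  rw [hcp, hcq, neg_mul_neg] at h1
  exact h1.lt_of_ne' (mul_ne_zero (fun h => hne (by rw [hcp, h, neg_zero])) hq)

lemma exists_mul_norm_le_supportΩ {ω : Fin N → ℝ} (hpos : ∀ i, 0 < ω i) (hω : NonResonant ω) :
    ∃ c, 0 < c ∧ ∀ p, c * ‖p‖ ≤ supportΩ ω p := by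
  -- The sphere is empty only for `N = 0`.
  rcases (Metric.sphere (0 : Phase N) 1).eq_empty_or_nonempty with he | hne
  · refine ⟨1, one_pos, fun p => ?_⟩
    by_cases hp : p = 0
    · simpa [hp] using supportΩ_nonneg (ω := ω) (0 : Phase N)
    · have : ‖p‖⁻¹ • p ∈ Metric.sphere (0 : Phase N) 1 := by
        simp [norm_smul, hp]
      simp [he] at this
  · obtain ⟨p₀, hp₀, hmin⟩ := (isCompact_sphere (0 : Phase N) 1).exists_isMinOn hne
      (continuous_supportΩ hω).continuousOn
    have hp₀' : p₀ ≠ 0 := fun h => by simp [h] at hp₀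
    refine ⟨supportΩ ω p₀, supportΩ_pos hpos hω hp₀', fun p => ?_⟩
    by_cases hp : p = 0
    · simpa [hp] using supportΩ_nonneg (ω := ω) (0 : Phase N)
    · have hn : 0 < ‖p‖ := norm_pos_iff.2 hp
      have h1 : supportΩ ω p₀ ≤ supportΩ ω (‖p‖⁻¹ • p) := hmin (by simp [norm_smul, hp])
      rw [supportΩ_smul hω (by positivity), ← div_eq_inv_mul, le_div_iff₀ hn] at h1
      exact h1

/-- The source of uniformity: norming momenta, uniform time means and the quantitative sign
statement all rest on this compactness. -/
lemma isCompact_supportΩ_eq_one {ω : Fin N → ℝ} (hpos : ∀ i, 0 < ω i) (hω : NonResonant ω) :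
    IsCompact {p : Phase N | supportΩ ω p = 1} := by
  obtain ⟨c, hc, h⟩ := exists_mul_norm_le_supportΩ hpos hω
  refine Metric.isCompact_of_isClosed_isBounded
    (isClosed_eq (continuous_supportΩ hω) continuous_const)
    ((Metric.isBounded_closedBall (x := (0 : Phase N)) (r := c⁻¹)).subset fun p hp => ?_)
  rw [mem_closedBall_zero_iff, ← one_div, le_div_iff₀' hc]
  exact (h p).trans_eq hp

/-- If the support function is almost additive on `p`, `q`, then `(B, p)` and `(B, q)` have the
same sign unless the latter is small. -/
theorem exists_wave_mul_pos {ω : Fin N → ℝ} (hpos : ∀ i, 0 < ω i) (hω : NonResonant ω)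
    {δ : ℝ} (hδ : 0 < δ) : ∃ γ > 0, ∀ p q : Phase N, supportΩ ω p = 1 → supportΩ ω q = 1 →
      2 - γ < supportΩ ω (p + q) → δ ≤ |wave ω q 0| → 0 < wave ω p 0 * wave ω q 0 := by
  let S := {p : Phase N | supportΩ ω p = 1}
  -- The compact set of pairs violating the conclusion. The maximum of `supportΩ (p + q)` on it is
  -- below `2` by rigidity, and `γ` is the gap.
  let K := (S ×ˢ S) ∩ {z : Phase N × Phase N | δ ≤ |wave ω z.2 0| ∧ wave ω z.1 0 * wave ω z.2 0 ≤ 0}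
  have hS := isCompact_supportΩ_eq_one hpos hω
  have h1 : Continuous fun z : Phase N × Phase N => wave ω z.1 0 :=
    (continuous_wave_left ω 0).comp continuous_fst
  have h2 : Continuous fun z : Phase N × Phase N => wave ω z.2 0 :=
    (continuous_wave_left ω 0).comp continuous_snd
  have hK : IsCompact K := (hS.prod hS).inter_right
    ((isClosed_le continuous_const h2.abs).inter (isClosed_le (h1.mul h2) continuous_const))
  rcases K.eq_empty_or_nonempty with he | hne
  · refine ⟨1, one_pos, fun p q hp hq _ hd => ?_⟩
    by_contra hc
    have : (p, q) ∈ K := ⟨⟨hp, hq⟩, hd, not_lt.1 hc⟩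
    simp [he] at this
  · have hadd : Continuous fun z : Phase N × Phase N => supportΩ ω (z.1 + z.2) :=
      (continuous_supportΩ hω).comp (continuous_fst.add continuous_snd)
    obtain ⟨⟨p₀, q₀⟩, ⟨⟨hp₀, hq₀⟩, hd₀, hs₀⟩, hmax⟩ := hK.exists_isMaxOn hne hadd.continuousOn
    simp only [S, Set.mem_ofPred_eq] at hp₀ hq₀ hd₀ hs₀
    refine ⟨2 - supportΩ ω (p₀ + q₀), ?_, fun p q hp hq hlt hd => ?_⟩
    · have hle := supportΩ_add_le hω p₀ q₀
      rw [hp₀, hq₀] at hle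
      refine sub_pos.2 (lt_of_le_of_ne (by linarith) fun heq => ?_)
      have hne0 : p₀ ≠ 0 := by
        rintro rfl
        have := supportΩ_smul hω le_rfl (0 : Phase N)
        rw [zero_smul, hp₀] at this
        norm_num at this
      have := wave_mul_pos_of_supportΩ_add hpos hω hne0 (by rw [heq, hp₀, hq₀]; norm_num)
        (abs_pos.1 (hδ.trans_le hd₀))
      exact this.not_ge hs₀
    · by_contra hc
      have : supportΩ ω (p + q) ≤ supportΩ ω (p₀ + q₀) :=
        hmax (a := (p, q)) ⟨⟨hp, hq⟩, hd, not_lt.1 hc⟩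
      linarith

/-! ### Differentiability of the support function; norming momenta. -/

/-- The zeros of a nonzero wave form a null set. -/
lemma ae_wave_ne_zero {ω : Fin N → ℝ} (hpos : ∀ i, 0 < ω i) {p : Phase N} (hp : p ≠ 0) :
    ∀ᵐ φ : Fin N → ℝ, wave ω p φ ≠ 0 := by
  obtain ⟨i, hi⟩ : ∃ i, p (1, i) ≠ 0 ∨ p (0, i) / ω i ≠ 0 := by
    by_contra! hc
    refine hp ?_
    ext ⟨k, i⟩
    fin_cases k
    · simpa [(hpos i).ne'] using (hc i).2
    · simpa using (hc i).1
  -- Fubini along a coordinate direction `i` in which the wave is not constant: on each such line it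
  -- is analytic and not identically zero.
  refine ae_mem_of_ae_add_linearMap_mem (s := {φ | wave ω p φ ≠ 0})
    (LinearMap.toSpanSingleton ℝ (Fin N → ℝ) (Pi.single i 1)) volume volume
    ((continuous_wave ω p).measurable (measurableSet_singleton 0).compl) fun φ => ?_
  have hline : ∀ t : ℝ, φ + LinearMap.toSpanSingleton ℝ (Fin N → ℝ) (Pi.single i 1) t =
      Function.update φ i (φ i + t) := by
    intro t
    ext j
    by_cases hj : j = i
    · subst hj; simp
    · simp [hj]
  simp only [hline, Set.mem_ofPred_eq]
  let g : ℝ → ℝ := fun t => wave ω p (Function.update φ i (φ i + t))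
  have hg : AnalyticOnNhd ℝ g Set.univ := by
    simp only [g, wave_update]
    intro t _
    fun_prop
  -- The differences of the values at phases `0, π` and at `±π/2` isolate the cosine and the sine
  -- coefficient.
  obtain ⟨t₀, ht₀⟩ : ∃ t, g t ≠ 0 := by
    by_contra! hc
    have h1 := hc (0 - φ i)
    have h2 := hc (Real.pi - φ i)
    have h3 := hc (Real.pi / 2 - φ i)
    have h4 := hc (-(Real.pi / 2) - φ i)
    simp only [g, wave_update, add_sub_cancel, Real.cos_zero, Real.sin_zero, Real.cos_pi,
      Real.sin_pi, Real.cos_pi_div_two, Real.sin_pi_div_two, Real.cos_neg, Real.sin_neg]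
      at h1 h2 h3 h4
    rcases hi with hi | hi
    · exact hi (by linarith)
    · exact hi (by linarith)
  have hmem := hg.preimage_zero_mem_codiscrete ht₀
  have := ae_restrict_le_codiscreteWithin (μ := (volume : Measure ℝ)) MeasurableSet.univ hmem
  rw [Measure.restrict_univ] at this
  filter_upwards [this] with t ht using ht

/-- The support function is differentiable away from the origin. -/
theorem differentiableAt_supportΩ {ω : Fin N → ℝ} (hpos : ∀ i, 0 < ω i) (hω : NonResonant ω)
    {p : Phase N} (hp : p ≠ 0) : DifferentiableAt ℝ (supportΩ ω) p := by
  obtain ⟨C, hC, hbd⟩ := exists_abs_wave_le ω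
  have hsign : AEStronglyMeasurable (fun φ => if 0 ≤ wave ω p φ then (1 : ℝ) else -1)
      ((volume : Measure (Fin N → ℝ)).restrict (box N)) :=
    (Measurable.ite ((continuous_wave ω p).measurable measurableSet_Ici)
      measurable_const measurable_const).aestronglyMeasurable
  have hvec : AEStronglyMeasurable (fun φ => innerSL ℝ (waveVec ω φ))
      ((volume : Measure (Fin N → ℝ)).restrict (box N)) :=
    ((innerSL ℝ).continuous.comp (continuous_waveVec ω)).aestronglyMeasurable
  have h := hasFDerivAt_integral_of_dominated_loc_of_lip
    (μ := (volume : Measure (Fin N → ℝ)).restrict (box N)) (𝕜 := ℝ)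
    (F := fun (q : Phase N) φ => |wave ω q φ|) (x₀ := p) (s := Set.univ) (bound := fun _ => C)
    (F' := fun φ => (if 0 ≤ wave ω p φ then (1 : ℝ) else -1) • innerSL ℝ (waveVec ω φ))
    univ_mem (Eventually.of_forall fun q => (continuous_wave ω q).abs.aestronglyMeasurable)
    (integrableOn_box (continuous_wave ω p).abs)
    (hsign.smul hvec)
    (Eventually.of_forall fun φ => by
      refine LipschitzOnWith.of_dist_le_mul fun q _ q' _ => ?_
      rw [Real.dist_eq, dist_eq_norm, Real.coe_nnabs, abs_of_nonneg hC]
      refine (abs_abs_sub_abs_le _ _).trans ?_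
      rw [← wave_sub]
      exact hbd _ _)
    (integrableOn_box continuous_const)
    (by
      filter_upwards [ae_restrict_of_ae (ae_wave_ne_zero hpos hp)] with φ hφ
      have hw : HasFDerivAt (fun q => wave ω q φ) (innerSL ℝ (waveVec ω φ)) p :=
        (innerSL ℝ (waveVec ω φ)).hasFDerivAt
      rcases lt_or_gt_of_ne hφ with hlt | hgt
      · rw [if_neg (not_le.2 hlt)]
        exact (hasDerivAt_abs_neg hlt).comp_hasFDerivAt p hw
      · rw [if_pos hgt.le]
        exact (hasDerivAt_abs_pos hgt).comp_hasFDerivAt p hw)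
  have e : supportΩ ω = fun q => ((2 * Real.pi) ^ N)⁻¹ * ∫ φ in box N, |wave ω q φ| :=
    funext fun q => supportΩ_eq_boxMean hω q
  rw [e]
  exact h.2.differentiableAt.const_mul _

/-- Every `x ≠ 0` has a normalized momentum, at which the support inequality is sharp. -/
theorem exists_norming {ω : Fin N → ℝ} (hpos : ∀ i, 0 < ω i) (hω : NonResonant ω)
    {x : Phase N} (hx : x ≠ 0) : ∃ q : Phase N, supportΩ ω q = 1 ∧ inner ℝ x q = rho ω x ∧
      0 < rho ω x ∧ ∀ p, inner ℝ x p ≤ rho ω x * supportΩ ω p := by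
  have hxpos := supportΩ_pos hpos hω hx
  have hunit : ∀ p : Phase N, p ≠ 0 → supportΩ ω ((supportΩ ω p)⁻¹ • p) = 1 := fun p hp => by
    have := supportΩ_pos hpos hω hp
    rw [supportΩ_smul hω (by positivity), inv_mul_cancel₀ this.ne']
  obtain ⟨q, hq, hmax⟩ := (isCompact_supportΩ_eq_one hpos hω).exists_isMaxOn
    ⟨_, hunit x hx⟩ (f := fun p => inner ℝ x p) (continuous_const.inner continuous_id).continuousOn
  have hle : ∀ p, inner ℝ x p ≤ inner ℝ x q * supportΩ ω p := by
    intro p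
    by_cases hp : p = 0
    · subst hp
      have := supportΩ_smul hω le_rfl (0 : Phase N)
      rw [zero_smul, zero_mul] at this
      simp [this]
    · have hpp := supportΩ_pos hpos hω hp
      have h1 : inner ℝ x ((supportΩ ω p)⁻¹ • p) ≤ inner ℝ x q := hmax (hunit p hp)
      rwa [real_inner_smul_right, inv_mul_le_iff₀ hpp, mul_comm] at h1
  have hm : 0 < inner ℝ x q := by
    have h1 := hle x
    have h2 : 0 < inner ℝ x x := real_inner_self_pos.2 hx
    exact pos_of_mul_pos_left (h2.trans_le h1) hxpos.le
  -- The admissible dilations form a closed ray whose endpoint is the maximum of `(x, ·)` on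
  -- normalized momenta; the gauge is its infimum.
  have hset : {r ∈ Set.Ioi (0 : ℝ) | r⁻¹ • x ∈ bodyΩ ω} = Set.Ici (inner ℝ x q) := by
    ext r
    simp only [bodyΩ, Set.mem_ofPred_eq, Set.mem_Ioi, Set.mem_Ici, real_inner_smul_left]
    constructor
    · rintro ⟨hr, h⟩
      have h1 := h q
      rwa [show supportΩ ω q = 1 from hq, inv_mul_le_iff₀ hr, mul_one] at h1
    · intro hr
      have hr0 := hm.trans_le hr
      refine ⟨hr0, fun p => ?_⟩
      rw [inv_mul_le_iff₀ hr0]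
      exact (hle p).trans (mul_le_mul_of_nonneg_right hr (supportΩ_nonneg p))
  have hrho : rho ω x = inner ℝ x q := by
    rw [rho, gauge_def', hset, csInf_Ici]
  exact ⟨q, hq, hrho.symm, hrho ▸ hm, fun p => hrho ▸ hle p⟩

lemma rho_zero (ω : Fin N → ℝ) : rho ω 0 = 0 := gauge_zero

lemma ne_zero_of_rho_pos {ω : Fin N → ℝ} {x : Phase N} (h : 0 < rho ω x) : x ≠ 0 := by
  rintro rfl
  simp [rho_zero] at h

lemma inner_le_rho_mul {ω : Fin N → ℝ} (hpos : ∀ i, 0 < ω i) (hω : NonResonant ω)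
    (x p : Phase N) : inner ℝ x p ≤ rho ω x * supportΩ ω p := by
  by_cases hx : x = 0
  · simp [hx, rho_zero]
  · exact (exists_norming hpos hω hx).choose_spec.2.2.2 p

/-- A normalized `q` with `(x, q) = ρ(x)` is a momentum at `x`. -/
theorem isMomentum_of_inner_eq {ω : Fin N → ℝ} (hpos : ∀ i, 0 < ω i) (hω : NonResonant ω)
    {x q : Phase N} (hx : 0 < rho ω x) (hq : supportΩ ω q = 1) (h : inner ℝ x q = rho ω x) :
    IsMomentum ω x q := by
  have hq0 : q ≠ 0 := by
    rintro rfl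
    rw [inner_zero_right] at h
    exact hx.ne h
  refine ⟨hq0, ?_⟩
  have hd := differentiableAt_supportΩ hpos hω hq0
  have hlin : HasFDerivAt (fun p => inner ℝ ((rho ω x)⁻¹ • x) p)
      (innerSL ℝ ((rho ω x)⁻¹ • x)) q := (innerSL ℝ ((rho ω x)⁻¹ • x)).hasFDerivAt
  -- The support inequality is an equality at `q`, so the gradient of the difference vanishes there.
  have hmin : IsLocalMin (fun p => supportΩ ω p - inner ℝ ((rho ω x)⁻¹ • x) p) q := by
    refine Eventually.of_forall fun p => ?_
    have := inner_le_rho_mul hpos hω x p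
    simp only [real_inner_smul_left, h, hq, inv_mul_cancel₀ hx.ne', sub_self]
    rw [sub_nonneg, inv_mul_le_iff₀ hx]
    exact this
  have hz := hmin.hasFDerivAt_eq_zero (hd.hasFDerivAt.sub hlin)
  rw [hasGradientAt_iff_hasFDerivAt]
  have : fderiv ℝ (supportΩ ω) q = innerSL ℝ ((rho ω x)⁻¹ • x) := sub_eq_zero.1 hz
  have h2 := hd.hasFDerivAt
  rw [this] at h2
  exact h2

/-- Time means of `|(B, p)|` converge uniformly on normalized momenta. -/
theorem exists_uniform_timeMean {ω : Fin N → ℝ} (hpos : ∀ i, 0 < ω i) (hω : NonResonant ω)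
    {ε : ℝ} (hε : 0 < ε) : ∃ L₀ > 0, ∀ L ≥ L₀, ∀ p : Phase N, supportΩ ω p = 1 →
      |(∫ t in (0 : ℝ)..L, |wave ω p fun i => t * ω i|) - L| ≤ ε * L := by
  obtain ⟨C, hC, hbd⟩ := exists_abs_wave_le ω
  -- Time means are `C`-Lipschitz in `p` whatever the length `L`, so a finite net reduces uniformity
  -- to finitely many limits. The `+ 1` covers `C = 0`.
  have hr : 0 < ε / (2 * (C + 1)) := by positivity
  obtain ⟨F, hFS, hF, hcov⟩ :=
    (isCompact_supportΩ_eq_one hpos hω).finite_cover_balls hr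
  have hev : ∀ᶠ L in atTop, ∀ q ∈ F,
      dist (timeMean (fun t => |wave ω q fun i => t * ω i|) L) (supportΩ ω q) < ε / 2 := by
    rw [eventually_all_finite hF]
    intro q _
    rw [supportΩ_eq_boxMean hω]
    exact Metric.tendsto_nhds.1 (tendsto_timeMean_wave hω q) _ (by positivity)
  obtain ⟨L₁, hL₁⟩ := eventually_atTop.1 hev
  refine ⟨max L₁ 1, by positivity, fun L hL p hp => ?_⟩
  have hL0 : 0 < L := one_pos.trans_le ((le_max_right _ _).trans hL)
  obtain ⟨q, hq, hpq⟩ := Set.mem_iUnion₂.1 (hcov hp)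
  have h1 := hL₁ L ((le_max_left _ _).trans hL) q hq
  rw [show supportΩ ω q = 1 from hFS hq] at h1
  have h2 : ‖timeMean (fun t => |wave ω p fun i => t * ω i| - |wave ω q fun i => t * ω i|) L‖ ≤
      C * ‖p - q‖ := by
    refine norm_timeMean_le hL0 fun t => ?_
    rw [Real.norm_eq_abs]
    refine (abs_abs_sub_abs_le _ _).trans ?_
    rw [← wave_sub]
    exact hbd _ _
  rw [timeMean_sub (by fun_prop) (by fun_prop)] at h2
  have h3 : C * ‖p - q‖ ≤ ε / 2 := by
    rw [Metric.mem_ball, dist_eq_norm] at hpq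
    calc C * ‖p - q‖ ≤ (C + 1) * (ε / (2 * (C + 1))) := by gcongr; linarith
      _ = ε / 2 := by field_simp
  have h4 : |timeMean (fun t => |wave ω p fun i => t * ω i|) L - 1| ≤ ε := by
    rw [Real.dist_eq] at h1
    rw [Real.norm_eq_abs] at h2
    rw [abs_le] at *
    rw [abs_lt] at h1
    constructor <;> linarith
  rw [timeMean, smul_eq_mul] at h4
  have h5 : (∫ t in (0 : ℝ)..L, |wave ω p fun i => t * ω i|) - L =
      (L⁻¹ * (∫ t in (0 : ℝ)..L, |wave ω p fun i => t * ω i|) - 1) * L := by field_simp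
  rw [h5, abs_mul, abs_of_pos hL0]
  gcongr

/-! ### The adjoint flow and the duality identity along motions. -/

/-- The flow of the adjoint system `p' = -Aᵀ p`. -/
def flow (ω : Fin N → ℝ) (t : ℝ) (p : Phase N) : Phase N :=
  WithLp.toLp 2 fun j =>
    (![p (0, j.2) * Real.cos (t * ω j.2) + ω j.2 * p (1, j.2) * Real.sin (t * ω j.2),
      p (1, j.2) * Real.cos (t * ω j.2) - p (0, j.2) / ω j.2 * Real.sin (t * ω j.2)] :
        Fin 2 → ℝ) j.1

lemma flow_apply_zero (ω : Fin N → ℝ) (t : ℝ) (p : Phase N) (i : Fin N) :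
    flow ω t p (0, i) =
      p (0, i) * Real.cos (t * ω i) + ω i * p (1, i) * Real.sin (t * ω i) := by
  simp [flow]

lemma flow_apply_one (ω : Fin N → ℝ) (t : ℝ) (p : Phase N) (i : Fin N) :
    flow ω t p (1, i) =
      p (1, i) * Real.cos (t * ω i) - p (0, i) / ω i * Real.sin (t * ω i) := by
  simp [flow]

lemma flow_flow {ω : Fin N → ℝ} (hpos : ∀ i, 0 < ω i) (s t : ℝ) (p : Phase N) :
    flow ω s (flow ω t p) = flow ω (s + t) p := by
  ext ⟨k, i⟩
  have := (hpos i).ne'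
  fin_cases k
  · change flow ω s (flow ω t p) (0, i) = flow ω (s + t) p (0, i)
    simp only [flow_apply_zero, flow_apply_one, add_mul, Real.cos_add, Real.sin_add]
    field_simp
    ring
  · change flow ω s (flow ω t p) (1, i) = flow ω (s + t) p (1, i)
    simp only [flow_apply_zero, flow_apply_one, add_mul, Real.cos_add, Real.sin_add]
    field_simp
    ring

lemma flow_zero (ω : Fin N → ℝ) (p : Phase N) : flow ω 0 p = p := by
  ext ⟨k, i⟩
  fin_cases k <;> simp [flow]

lemma amplitude_flow {ω : Fin N → ℝ} (hpos : ∀ i, 0 < ω i) (t : ℝ) (p : Phase N) :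
    amplitude ω (flow ω t p) = amplitude ω p := by
  funext i
  have := (hpos i).ne'
  rw [amplitude, amplitude, flow_apply_zero, flow_apply_one]
  congr 1
  have h := Real.sin_sq_add_cos_sq (t * ω i)
  field_simp
  linear_combination (ω i ^ 2 * p (1, i) ^ 2 + p (0, i) ^ 2) * h

lemma supportΩ_flow {ω : Fin N → ℝ} (hpos : ∀ i, 0 < ω i) (t : ℝ) (p : Phase N) :
    supportΩ ω (flow ω t p) = supportΩ ω p := by
  rw [supportΩ, amplitude_flow hpos, supportΩ]

lemma wave_zero (ω : Fin N → ℝ) (p : Phase N) : wave ω p 0 = inner ℝ (vecB N) p := by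
  simp [wave_eq_sum, inner_phase, vecB]

lemma wave_flow {ω : Fin N → ℝ} (hpos : ∀ i, 0 < ω i) (s t : ℝ) (p : Phase N) :
    wave ω (flow ω s p) (fun i => t * ω i) = wave ω p fun i => (t + s) * ω i := by
  simp only [wave_eq_sum, flow_apply_zero, flow_apply_one]
  refine Finset.sum_congr rfl fun i _ => ?_
  have := (hpos i).ne'
  rw [add_mul, Real.cos_add, Real.sin_add]
  field_simp
  ring

lemma wave_flow_zero {ω : Fin N → ℝ} (hpos : ∀ i, 0 < ω i) (s : ℝ) (p : Phase N) :
    wave ω (flow ω s p) 0 = wave ω p fun i => s * ω i := by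
  have := wave_flow hpos s 0 p
  simpa [Pi.zero_def] using this

/-- The product rule for an indefinite integral and a continuously differentiable function. -/
lemma integral_mul_add_eq_sub {f P P' : ℝ → ℝ} {a b c : ℝ} (hf : IntervalIntegrable f volume a b)
    (hP : ∀ t, HasDerivAt P (P' t) t) (hP' : Continuous P') :
    ∫ t in a..b, (f t * P t + (c + ∫ s in a..t, f s) * P' t) =
      (c + ∫ s in a..b, f s) * P b - c * P a := by
  have hY : AbsolutelyContinuousOnInterval (fun t => c + ∫ s in a..t, f s) a b :=
    AbsolutelyContinuousOnInterval.add
      (contDiff_const (c := c)).contDiffOn.absolutelyContinuousOnInterval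
      (hf.absolutelyContinuousOnInterval_intervalIntegral (by simp))
  have hderiv : deriv P = P' := funext fun t => (hP t).deriv
  have hPac : AbsolutelyContinuousOnInterval P a b := by
    refine ContDiffOn.absolutelyContinuousOnInterval (ContDiff.contDiffOn ?_)
    rw [contDiff_one_iff_deriv, hderiv]
    exact ⟨fun t => (hP t).differentiableAt, hP'⟩
  have h := hY.integral_deriv_mul_eq_sub hPac
  simp only [intervalIntegral.integral_same, add_zero] at h
  rw [← h]
  refine intervalIntegral.integral_congr_ae ?_
  filter_upwards [hf.ae_hasDerivAt_integral] with t ht hmem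
  have hd := ((ht (Set.uIoc_subset_uIcc hmem) a (by simp)).const_add c).deriv
  rw [hd, hderiv]

lemma matA_apply_zero (ω : Fin N → ℝ) (x : Phase N) (i : Fin N) :
    Matrix.toEuclideanCLM (𝕜 := ℝ) (matA ω) x (0, i) = x (1, i) := by
  rw [Matrix.ofLp_toEuclideanCLM]
  simp [matA, Matrix.mulVec, dotProduct, Fintype.sum_prod_type, Matrix.blockDiagonal_apply]

lemma matA_apply_one (ω : Fin N → ℝ) (x : Phase N) (i : Fin N) :
    Matrix.toEuclideanCLM (𝕜 := ℝ) (matA ω) x (1, i) = -(ω i) ^ 2 * x (0, i) := by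
  rw [Matrix.ofLp_toEuclideanCLM]
  simp [matA, Matrix.mulVec, dotProduct, Fintype.sum_prod_type, Matrix.blockDiagonal_apply]

lemma IsMotion.intervalIntegrable_control {ω : Fin N → ℝ} {T : ℝ} {x : ℝ → Phase N} {u : ℝ → ℝ}
    (h : IsMotion ω T x u) {s t : ℝ} (hs : s ∈ Set.Icc 0 T) (ht : t ∈ Set.Icc 0 T) :
    IntervalIntegrable u volume s t := by
  have h1 : IntegrableOn u (Set.Icc 0 T) :=
    Integrable.mono' (integrable_const (1 : ℝ)) h.aemeasurable.aestronglyMeasurable h.abs_le_one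
  exact (h1.mono_set (Set.uIcc_subset_Icc hs ht)).intervalIntegrable

lemma IsMotion.intervalIntegrable_velocity {ω : Fin N → ℝ} {T : ℝ} {x : ℝ → Phase N} {u : ℝ → ℝ}
    (h : IsMotion ω T x u) {t : ℝ} (ht : t ∈ Set.Icc 0 T) :
    IntervalIntegrable (fun s => Matrix.toEuclideanCLM (𝕜 := ℝ) (matA ω) (x s) + u s • vecB N)
      volume 0 t := by
  have h0 : (0 : ℝ) ∈ Set.Icc 0 T := ⟨le_rfl, ht.1.trans ht.2⟩
  refine IntervalIntegrable.add (ContinuousOn.intervalIntegrable ?_) ?_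
  · exact (Matrix.toEuclideanCLM (𝕜 := ℝ) (matA ω)).continuous.comp_continuousOn
      (h.continuousOn.mono (Set.uIcc_subset_Icc h0 ht))
  · exact (h.intervalIntegrable_control h0 ht).smul_continuousOn continuousOn_const

/-- Integrated form of `d/dt (x, p) = u (B, p)` along a solution `p` of the adjoint system. -/
theorem IsMotion.inner_flow_eq_zero_add {ω : Fin N → ℝ} (hpos : ∀ i, 0 < ω i) {T : ℝ}
    {x : ℝ → Phase N} {u : ℝ → ℝ} (h : IsMotion ω T x u) (p : Phase N) {t : ℝ}
    (ht : t ∈ Set.Icc 0 T) :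
    inner ℝ (x t) (flow ω t p) = inner ℝ (x 0) p + ∫ s in (0 : ℝ)..t,
      u s * wave ω p (fun i => s * ω i) := by
  let g : ℝ → Phase N := fun s => Matrix.toEuclideanCLM (𝕜 := ℝ) (matA ω) (x s) + u s • vecB N
  have hg := h.intervalIntegrable_velocity ht
  have hsub : ∀ {s : ℝ}, s ∈ Set.uIcc 0 t → s ∈ Set.Icc 0 T := fun {s} hs => by
    rw [Set.uIcc_of_le ht.1] at hs
    exact ⟨hs.1, hs.2.trans ht.2⟩
  have hgj : ∀ j, IntervalIntegrable (fun s => g s j) volume 0 t := fun j =>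
    ⟨(EuclideanSpace.proj (𝕜 := ℝ) j).integrable_comp hg.1,
      (EuclideanSpace.proj (𝕜 := ℝ) j).integrable_comp hg.2⟩
  have hx : ∀ j, ∀ s ∈ Set.uIcc 0 t, x s j = x 0 j + ∫ r in (0 : ℝ)..s, g r j := by
    intro j s hs
    have h1 := h.eq_integral s (hsub hs)
    have h2 := (EuclideanSpace.proj (𝕜 := ℝ) j).intervalIntegral_comp_comm
      (h.intervalIntegrable_velocity (hsub hs))
    have h3 := congrArg (EuclideanSpace.proj (𝕜 := ℝ) j) h1
    rw [map_add, ← h2] at h3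
    exact h3
  have hP0 : ∀ i s, HasDerivAt (fun s => flow ω s p (0, i)) (ω i ^ 2 * flow ω s p (1, i)) s := by
    intro i s
    simp only [flow_apply_zero, flow_apply_one]
    have hl : HasDerivAt (fun s : ℝ => s * ω i) (ω i) s := by
      simpa using (hasDerivAt_id s).mul_const (ω i)
    refine ((hl.cos.const_mul (p (0, i))).fun_add
      (hl.sin.const_mul (ω i * p (1, i)))).congr_deriv ?_
    have := (hpos i).ne'
    field_simp
    ring
  have hP1 : ∀ i s, HasDerivAt (fun s => flow ω s p (1, i)) (-flow ω s p (0, i)) s := by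
    intro i s
    simp only [flow_apply_zero, flow_apply_one]
    have hl : HasDerivAt (fun s : ℝ => s * ω i) (ω i) s := by
      simpa using (hasDerivAt_id s).mul_const (ω i)
    refine ((hl.cos.const_mul (p (1, i))).fun_sub
      (hl.sin.const_mul (p (0, i) / ω i))).congr_deriv ?_
    have := (hpos i).ne'
    field_simp
    ring
  have hc0 : ∀ i, Continuous fun s => flow ω s p (0, i) := fun i =>
    continuous_iff_continuousAt.2 fun s => (hP0 i s).continuousAt
  have hc1 : ∀ i, Continuous fun s => flow ω s p (1, i) := fun i =>
    continuous_iff_continuousAt.2 fun s => (hP1 i s).continuousAt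
  have key : ∀ i, x t (0, i) * flow ω t p (0, i) + x t (1, i) * flow ω t p (1, i) =
      (x 0 (0, i) * p (0, i) + x 0 (1, i) * p (1, i)) +
        ∫ s in (0 : ℝ)..t, u s * flow ω s p (1, i) := by
    intro i
    have e0 := integral_mul_add_eq_sub (c := x 0 (0, i)) (hgj (0, i)) (hP0 i)
      ((hc1 i).const_mul _)
    have e1 := integral_mul_add_eq_sub (c := x 0 (1, i)) (hgj (1, i)) (hP1 i) (hc0 i).neg
    rw [← hx _ t (by simp), flow_zero] at e0 e1
    have hY : ∀ j, ContinuousOn (fun s => x 0 j + ∫ r in (0 : ℝ)..s, g r j) (Set.uIcc 0 t) := by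
      intro j
      refine ContinuousOn.congr ?_ fun s hs => (hx j s hs).symm
      exact (EuclideanSpace.proj (𝕜 := ℝ) j).continuous.comp_continuousOn
        (h.continuousOn.mono fun s hs => hsub hs)
    have i0 := ((hgj (0, i)).mul_continuousOn (hc0 i).continuousOn).add
      ((hY (0, i)).mul ((hc1 i).const_mul (ω i ^ 2)).continuousOn).intervalIntegrable
    have i1 := ((hgj (1, i)).mul_continuousOn (hc1 i).continuousOn).add
      ((hY (1, i)).mul (hc0 i).neg.continuousOn).intervalIntegrable
    have hsum := (intervalIntegral.integral_add i0 i1).trans (congrArg₂ (· + ·) e0 e1)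
    -- The terms coming from `A` and from `-Aᵀ` cancel in the sum of the two product rules; only the
    -- control term remains.
    have hcongr : ∫ s in (0 : ℝ)..t, u s * flow ω s p (1, i) =
        x t (0, i) * flow ω t p (0, i) - x 0 (0, i) * p (0, i) +
          (x t (1, i) * flow ω t p (1, i) - x 0 (1, i) * p (1, i)) := by
      rw [← hsum]
      refine intervalIntegral.integral_congr fun s hs => ?_
      simp only [Pi.mul_apply, Pi.neg_apply, ← hx _ s hs]
      have g0 : g s (0, i) = x s (1, i) := by
        simp only [g, PiLp.add_apply, PiLp.smul_apply, matA_apply_zero]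
        simp [vecB]
      have g1 : g s (1, i) = -(ω i) ^ 2 * x s (0, i) + u s := by
        simp only [g, PiLp.add_apply, PiLp.smul_apply, matA_apply_one]
        simp [vecB]
      rw [g0, g1]
      ring
    rw [hcongr]
    ring
  rw [inner_phase, inner_phase, Finset.sum_congr rfl fun i _ => key i, Finset.sum_add_distrib,
    ← intervalIntegral.integral_finsetSum]
  · congr 1
    refine intervalIntegral.integral_congr fun s _ => ?_
    simp only [← Finset.mul_sum]
    rw [← wave_flow_zero hpos, wave_zero, inner_phase]
    simp [vecB]
  · intro i _
    exact (h.intervalIntegrable_control ⟨le_rfl, ht.1.trans ht.2⟩ ht).mul_continuousOn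
      (hc1 i).continuousOn

lemma IsMotion.intervalIntegrable_control_mul_wave {ω : Fin N → ℝ} {T : ℝ} {x : ℝ → Phase N}
    {u : ℝ → ℝ} (h : IsMotion ω T x u) (p : Phase N) {s t : ℝ} (hs : s ∈ Set.Icc 0 T)
    (ht : t ∈ Set.Icc 0 T) :
    IntervalIntegrable (fun r => u r * wave ω p fun i => r * ω i) volume s t :=
  (h.intervalIntegrable_control hs ht).mul_continuousOn (by fun_prop)

theorem IsMotion.inner_flow_eq {ω : Fin N → ℝ} (hpos : ∀ i, 0 < ω i) {T : ℝ} {x : ℝ → Phase N}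
    {u : ℝ → ℝ} (h : IsMotion ω T x u) (p : Phase N) {s t : ℝ} (hs : s ∈ Set.Icc 0 T)
    (ht : t ∈ Set.Icc 0 T) :
    inner ℝ (x t) (flow ω t p) = inner ℝ (x s) (flow ω s p) + ∫ r in s..t,
      u r * wave ω p (fun i => r * ω i) := by
  have h0 : (0 : ℝ) ∈ Set.Icc 0 T := ⟨le_rfl, hs.1.trans hs.2⟩
  rw [h.inner_flow_eq_zero_add hpos p hs, h.inner_flow_eq_zero_add hpos p ht, add_assoc,
    intervalIntegral.integral_add_adjacent_intervals
      (h.intervalIntegrable_control_mul_wave p h0 hs)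
      (h.intervalIntegrable_control_mul_wave p hs ht)]

lemma intervalIntegrable_abs_wave (ω : Fin N → ℝ) (p : Phase N) (s t : ℝ) :
    IntervalIntegrable (fun r => |wave ω p fun i => r * ω i|) volume s t := by
  have : Continuous fun r : ℝ => |wave ω p fun i => r * ω i| := by fun_prop
  exact this.intervalIntegrable _ _

lemma IsMotion.abs_integral_le {ω : Fin N → ℝ} {T : ℝ} {x : ℝ → Phase N} {u : ℝ → ℝ}
    (h : IsMotion ω T x u) (p : Phase N) {s t : ℝ} (hs : 0 ≤ s) (hst : s ≤ t) (ht : t ≤ T) :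
    |∫ r in s..t, u r * wave ω p (fun i => r * ω i)| ≤
      ∫ r in s..t, |wave ω p fun i => r * ω i| := by
  rw [← Real.norm_eq_abs]
  refine intervalIntegral.norm_integral_le_of_norm_le hst ?_ (intervalIntegrable_abs_wave ω p s t)
  filter_upwards [(ae_restrict_iff' measurableSet_Icc).1 h.abs_le_one] with r hr hmem
  rw [Real.norm_eq_abs, abs_mul]
  exact mul_le_of_le_one_left (abs_nonneg _) (hr ⟨hs.trans hmem.1.le, hmem.2.trans ht⟩)

/-! ### Estimates for the radial coordinate. -/

/-- A norming momentum at time `t`, transported back along the adjoint flow. -/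
lemma exists_norming_flow {ω : Fin N → ℝ} (hpos : ∀ i, 0 < ω i) (hω : NonResonant ω)
    {x : Phase N} (hx : x ≠ 0) (t : ℝ) :
    ∃ p : Phase N, supportΩ ω p = 1 ∧ inner ℝ x (flow ω t p) = rho ω x := by
  obtain ⟨q, hq, hxq, -⟩ := exists_norming hpos hω hx
  refine ⟨flow ω (-t) q, by rw [supportΩ_flow hpos, hq], ?_⟩
  rw [flow_flow hpos, add_neg_cancel, flow_zero, hxq]

/-- The flow preserves normalization, so this makes the uniform time mean from `0` available on any
window. -/
lemma integral_abs_wave_shift {ω : Fin N → ℝ} (hpos : ∀ i, 0 < ω i) (p : Phase N) (s t : ℝ) :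
    ∫ r in s..t, |wave ω p fun i => r * ω i| =
      ∫ r in (0 : ℝ)..(t - s), |wave ω (flow ω s p) fun i => r * ω i| := by
  simp_rw [wave_flow hpos]
  rw [intervalIntegral.integral_comp_add_right (fun r => |wave ω p fun i => r * ω i|) s]
  simp

lemma exists_abs_wave_le_of_normalized {ω : Fin N → ℝ} (hpos : ∀ i, 0 < ω i)
    (hω : NonResonant ω) : ∃ K, 0 < K ∧ ∀ p φ, supportΩ ω p = 1 → |wave ω p φ| ≤ K := by
  obtain ⟨C, hC, hbd⟩ := exists_abs_wave_le ω
  obtain ⟨c, hc, hle⟩ := exists_mul_norm_le_supportΩ hpos hω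
  refine ⟨C * c⁻¹ + 1, by positivity, fun p φ hp => (hbd p φ).trans ?_⟩
  have h1 : ‖p‖ ≤ c⁻¹ := by
    rw [← one_div, le_div_iff₀' hc]
    exact (hle p).trans_eq hp
  have := mul_le_mul_of_nonneg_left h1 hC
  linarith

lemma integral_abs_wave_le {ω : Fin N → ℝ} {K : ℝ} {p : Phase N}
    (hK : ∀ φ, |wave ω p φ| ≤ K) {s t : ℝ} (hst : s ≤ t) :
    ∫ r in s..t, |wave ω p fun i => r * ω i| ≤ K * (t - s) := by
  have := intervalIntegral.integral_mono_on (g := fun _ => K) hst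
    (intervalIntegrable_abs_wave ω p s t) intervalIntegrable_const fun r _ => hK _
  simpa [mul_comm] using this

/-- The radial coordinate changes at bounded speed. -/
lemma IsMotion.abs_rho_sub_le {ω : Fin N → ℝ} (hpos : ∀ i, 0 < ω i) (hω : NonResonant ω) {K : ℝ}
    (hK0 : 0 ≤ K) (hK : ∀ p φ, supportΩ ω p = 1 → |wave ω p φ| ≤ K) {T : ℝ} {x : ℝ → Phase N}
    {u : ℝ → ℝ} (h : IsMotion ω T x u) {s t : ℝ} (hs : 0 ≤ s) (hst : s ≤ t) (ht : t ≤ T) :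
    |rho ω (x t) - rho ω (x s)| ≤ K * (t - s) := by
  have hs' : s ∈ Set.Icc 0 T := ⟨hs, hst.trans ht⟩
  have ht' : t ∈ Set.Icc 0 T := ⟨hs.trans hst, ht⟩
  have hnn : 0 ≤ K * (t - s) := mul_nonneg hK0 (sub_nonneg.2 hst)
  have hrho : ∀ y : Phase N, 0 ≤ rho ω y := fun y => gauge_nonneg y
  have hbound : ∀ p, supportΩ ω p = 1 →
      |∫ r in s..t, u r * wave ω p (fun i => r * ω i)| ≤ K * (t - s) := fun p hp =>
    (h.abs_integral_le p hs hst ht).trans (integral_abs_wave_le (fun φ => hK p φ hp) hst)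
  rw [abs_le]
  -- The lower bound tests with the norming momentum of `x s`, the upper one with that of `x t`. At
  -- the origin there is none, but there `ρ = 0`.
  constructor
  · by_cases hx : x s = 0
    · rw [hx, rho_zero]
      linarith [hrho (x t)]
    · obtain ⟨p, hp, he⟩ := exists_norming_flow hpos hω hx s
      have h1 := h.inner_flow_eq hpos p hs' ht'
      have h2 := inner_le_rho_mul hpos hω (x t) (flow ω t p)
      rw [supportΩ_flow hpos, hp, mul_one] at h2
      linarith [(abs_le.1 (hbound p hp)).1]
  · by_cases hx : x t = 0
    · rw [hx, rho_zero]
      linarith [hrho (x s)]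
    · obtain ⟨p, hp, he⟩ := exists_norming_flow hpos hω hx t
      have h1 := h.inner_flow_eq hpos p hs' ht'
      have h2 := inner_le_rho_mul hpos hω (x s) (flow ω s p)
      rw [supportΩ_flow hpos, hp, mul_one] at h2
      linarith [(abs_le.1 (hbound p hp)).2]

/-- No admissible control decreases the radial coordinate asymptotically faster than at unit
speed. -/
theorem exists_rho_sub_le {ω : Fin N → ℝ} (hpos : ∀ i, 0 < ω i) (hω : NonResonant ω) {ε : ℝ}
    (hε : 0 < ε) : ∃ L₀ > 0, ∀ (T : ℝ) (x : ℝ → Phase N) (u : ℝ → ℝ), IsMotion ω T x u →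
      L₀ ≤ T → rho ω (x 0) - rho ω (x T) ≤ (1 + ε) * T := by
  obtain ⟨L₀, hL₀, hmean⟩ := exists_uniform_timeMean hpos hω hε
  refine ⟨L₀, hL₀, fun T x u h hT => ?_⟩
  have hT0 : 0 < T := hL₀.trans_le hT
  by_cases hx : x 0 = 0
  · rw [hx, rho_zero]
    have : 0 ≤ rho ω (x T) := gauge_nonneg _
    nlinarith
  · obtain ⟨p, hp, he⟩ := exists_norming_flow hpos hω hx 0
    have h1 := h.inner_flow_eq hpos p (s := 0) (t := T) ⟨le_rfl, hT0.le⟩ ⟨hT0.le, le_rfl⟩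
    have h2 := inner_le_rho_mul hpos hω (x T) (flow ω T p)
    rw [supportΩ_flow hpos, hp, mul_one] at h2
    have h3 := (abs_le.1 (h.abs_integral_le p le_rfl hT0.le le_rfl)).1
    have h4 := (abs_le.1 (hmean T hT p hp)).2
    linarith

/-- Under the feedback, far from the origin, the radial coordinate decreases at least at almost
unit speed on time intervals of a suitable length. -/
theorem exists_feedback_decrease {ω : Fin N → ℝ} (hpos : ∀ i, 0 < ω i) (hω : NonResonant ω)
    {ε : ℝ} (hε : 0 < ε) : ∃ L₀ > 0, ∃ R, ∀ (T : ℝ) (x : ℝ → Phase N) (u : ℝ → ℝ),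
      IsFeedbackMotion ω T x u → ∀ a b : ℝ, 0 ≤ a → b ≤ T → L₀ ≤ b - a → b - a ≤ 2 * L₀ →
        R ≤ rho ω (x b) → rho ω (x b) + (1 - ε) * (b - a) ≤ rho ω (x a) := by
  obtain ⟨L₀, hL₀, hmean⟩ := exists_uniform_timeMean hpos hω (half_pos hε)
  obtain ⟨K, hK0, hK⟩ := exists_abs_wave_le_of_normalized hpos hω
  obtain ⟨γ, hγ, hsign⟩ := exists_wave_mul_pos hpos hω (δ := ε / 4) (by positivity)
  -- Put `D = K * (2 * L₀)`, a bound for the change of `ρ` and of `(x, p)` over the window. The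
  -- threshold keeps `ρ(s) > 2D/γ` throughout.
  refine ⟨L₀, hL₀, K * (2 * L₀) + 2 * (K * (2 * L₀)) / γ + 1, ?_⟩
  intro T x u h a b ha hb hab hab' hR
  have hle : a ≤ b := by linarith
  have ha' : a ∈ Set.Icc 0 T := ⟨ha, hle.trans hb⟩
  have hb' : b ∈ Set.Icc 0 T := ⟨ha.trans hle, hb⟩
  have hD : 0 < K * (2 * L₀) := by positivity
  have hDγ : 0 < 2 * (K * (2 * L₀)) / γ := by positivity
  have hxb : x b ≠ 0 := ne_zero_of_rho_pos (ω := ω) (by linarith)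
  obtain ⟨p, hp, he⟩ := exists_norming_flow hpos hω hxb b
  have hcontrol : ∀ᵐ s : ℝ, s ∈ Set.Ioc a b → u s * wave ω p (fun i => s * ω i) ≤
      -|wave ω p fun i => s * ω i| + ε / 2 := by
    filter_upwards [(ae_restrict_iff' measurableSet_Icc).1 h.abs_le_one,
      (ae_restrict_iff' measurableSet_Icc).1 h.feedback] with s hu hfb hs
    have hs' : s ∈ Set.Icc 0 T := ⟨ha.trans hs.1.le, hs.2.trans hb⟩
    replace hu := hu hs'
    have hlen : K * (b - s) ≤ K * (2 * L₀) :=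
      mul_le_mul_of_nonneg_left (by linarith [hs.1]) hK0.le
    have hrho := abs_le.1 (h.toIsMotion.abs_rho_sub_le hpos hω hK0.le hK hs'.1 hs.2 hb)
    have hrs : 2 * (K * (2 * L₀)) / γ < rho ω (x s) := by linarith [hrho.2]
    have hrs0 : 0 < rho ω (x s) := hDγ.trans hrs
    obtain ⟨q, hq, hxq, -, -⟩ := exists_norming hpos hω (ne_zero_of_rho_pos hrs0)
    have hpair := h.toIsMotion.inner_flow_eq hpos p hs' hb'
    have hint := abs_le.1 ((h.toIsMotion.abs_integral_le p hs'.1 hs.2 hb).trans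
      (integral_abs_wave_le (fun φ => hK p φ hp) hs.2))
    have hadd := inner_le_rho_mul hpos hω (x s) (q + flow ω s p)
    rw [inner_add_right, hxq] at hadd
    -- Since `(x(s), p(s)) ≥ ρ(s) - 2D`, pairing `x(s)` with `q + p(s)` gives at least `2ρ(s) - 2D >
    -- (2 - γ) ρ(s)`.
    have hclose : 2 - γ < supportΩ ω (q + flow ω s p) := by
      rw [div_lt_iff₀ hγ] at hrs
      have h1 : rho ω (x s) * (2 - γ) < rho ω (x s) * supportΩ ω (q + flow ω s p) := by
        linarith [hint.2, hrho.1]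
      exact lt_of_mul_lt_mul_left h1 hrs0.le
    have hw := hsign q (flow ω s p) hq (by rw [supportΩ_flow hpos, hp]) hclose
    rw [wave_flow_zero hpos] at hw
    generalize wave ω p (fun i => s * ω i) = w at hw ⊢
    -- If `|w| < ε/4`, any admissible `u` loses at most `2|w| < ε/2` against the optimal value
    -- `-|w|`; otherwise the feedback is exactly optimal. The other `ε/2` is spent on the time mean.
    by_cases hsmall : ε / 4 ≤ |w|
    · have hprod := hw hsmall
      have hu' := hfb hs' q (isMomentum_of_inner_eq hpos hω hrs0 hq hxq)
      rw [← wave_zero ω] at hu'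
      rcases lt_trichotomy (wave ω q 0) 0 with hneg | hzero | hpos'
      · have hw0 : w < 0 := neg_of_mul_pos_right hprod hneg.le
        rw [hu' hneg.ne, Real.sign_of_neg hneg, abs_of_neg hw0]
        linarith
      · rw [hzero, zero_mul] at hprod
        exact absurd hprod (lt_irrefl _)
      · have hw0 : 0 < w := pos_of_mul_pos_right hprod hpos'.le
        rw [hu' hpos'.ne', Real.sign_of_pos hpos', abs_of_pos hw0]
        linarith
    · have h1 : u s * w ≤ |w| := by
        refine (le_abs_self _).trans ?_
        rw [abs_mul]
        exact mul_le_of_le_one_left (abs_nonneg _) hu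
      linarith [not_le.1 hsmall]
  have hneg : IntervalIntegrable (fun s => -|wave ω p fun i => s * ω i|) volume a b :=
    (intervalIntegrable_abs_wave ω p a b).neg
  have hint : ∫ s in a..b, u s * wave ω p (fun i => s * ω i) ≤
      ∫ s in a..b, (-|wave ω p fun i => s * ω i| + ε / 2) := by
    rw [intervalIntegral.integral_of_le hle, intervalIntegral.integral_of_le hle]
    exact setIntegral_mono_on_ae
      (h.toIsMotion.intervalIntegrable_control_mul_wave p ha' hb').1
      (hneg.add intervalIntegrable_const).1 measurableSet_Ioc hcontrol
  rw [intervalIntegral.integral_add hneg intervalIntegrable_const,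
    intervalIntegral.integral_neg, intervalIntegral.integral_const, smul_eq_mul,
    integral_abs_wave_shift hpos] at hint
  have hm := (abs_le.1 (hmean (b - a) hab (flow ω a p) (by rw [supportΩ_flow hpos, hp]))).1
  have hpair := h.toIsMotion.inner_flow_eq hpos p ha' hb'
  have hxa := inner_le_rho_mul hpos hω (x a) (flow ω a p)
  rw [supportΩ_flow hpos, hp, mul_one] at hxa
  linarith

/-- Under the feedback, far from the origin, the radial coordinate decreases at least at almost
unit speed on all long time intervals. -/
theorem exists_le_rho_sub {ω : Fin N → ℝ} (hpos : ∀ i, 0 < ω i) (hω : NonResonant ω)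
    {ε : ℝ} (hε : 0 < ε) (hε1 : ε < 1) : ∃ M, ∀ (T : ℝ) (x : ℝ → Phase N) (u : ℝ → ℝ),
      IsFeedbackMotion ω T x u → M ≤ rho ω (x T) → M ≤ T →
        (1 - ε) * T ≤ rho ω (x 0) - rho ω (x T) := by
  obtain ⟨L₀, hL₀, R, hdec⟩ := exists_feedback_decrease hpos hω hε
  refine ⟨max L₀ R, fun T x u h hR hT => ?_⟩
  have hTL : L₀ ≤ T := (le_max_left _ _).trans hT
  have hT0 : 0 < T := hL₀.trans_le hTL
  have hR' : R ≤ rho ω (x T) := (le_max_right _ _).trans hR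
  -- Cutting `[0, T]` into `n` equal windows puts their length `T / n` between `L₀` and `2 * L₀`.
  set n := ⌊T / L₀⌋₊ with hn
  have hn1 : 1 ≤ n := Nat.one_le_floor_iff _ |>.2 ((one_le_div hL₀).2 hTL)
  have hn1' : (1 : ℝ) ≤ n := by exact_mod_cast hn1
  have hn0 : (0 : ℝ) < n := by linarith
  have hle : n * L₀ ≤ T := (le_div_iff₀ hL₀).1 (Nat.floor_le (by positivity))
  have hlt : T < (n + 1) * L₀ := (div_lt_iff₀ hL₀).1 (Nat.lt_floor_add_one _)
  have hL1 : L₀ ≤ T / n := by rw [le_div_iff₀ hn0]; linarith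
  have hL2 : T / n ≤ 2 * L₀ := by
    rw [div_le_iff₀ hn0]
    nlinarith
  have hL : 0 < T / n := by positivity
  have hnL : n * (T / n) = T := by field_simp
  -- Going backward from `T`, the radial coordinate at the window ends only grows, so the threshold
  -- `R`, assumed only at time `T`, holds at the right end of every window.
  have hstep : ∀ k : ℕ, k ≤ n →
      rho ω (x T) + k * ((1 - ε) * (T / n)) ≤ rho ω (x (T - k * (T / n))) := by
    intro k
    induction k with
    | zero => simp
    | succ k ih =>
      intro hk
      have hkn : ((k + 1 : ℕ) : ℝ) ≤ n := by exact_mod_cast hk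
      push_cast at hkn ⊢
      have ih := ih (by omega)
      have hk0 : (0 : ℝ) ≤ k := k.cast_nonneg
      have hkL : 0 ≤ k * (T / n) := by positivity
      have hmul : (k + 1) * (T / n) ≤ n * (T / n) := by gcongr
      have hnn : 0 ≤ k * ((1 - ε) * (T / n)) :=
        mul_nonneg hk0 (mul_nonneg (by linarith) hL.le)
      have hd : T - k * (T / n) - (T - (k + 1) * (T / n)) = T / n := by ring
      have := hdec T x u h (T - (k + 1) * (T / n)) (T - k * (T / n)) (by linarith) (by linarith)
        (by rw [hd]; exact hL1) (by rw [hd]; exact hL2) (by linarith)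
      rw [hd] at this
      linarith
  have hfin := hstep n le_rfl
  rw [hnL, sub_self] at hfin
  have e : n * ((1 - ε) * (T / n)) = (1 - ε) * T := by field_simp
  linarith

end Oscillators

end

theorem theorem1 {N : ℕ} (ω : Fin N → ℝ) (hpos : ∀ i, 0 < ω i)
    (hω : Oscillators.NonResonant ω) :
    (∀ ε : ℝ, 0 < ε → ∃ M₀ : ℝ, ∀ (T : ℝ) (x : ℝ → Oscillators.Phase N) (u : ℝ → ℝ),
      Oscillators.IsFeedbackMotion ω T x u →
      M₀ ≤ min (min (Oscillators.rho ω (x 0)) (Oscillators.rho ω (x T))) T →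
      |(Oscillators.rho ω (x 0) - Oscillators.rho ω (x T)) / T - 1| ≤ ε) ∧
    (∀ ε : ℝ, 0 < ε → ∃ M₀ : ℝ, ∀ (T : ℝ) (x : ℝ → Oscillators.Phase N) (u : ℝ → ℝ),
      Oscillators.IsMotion ω T x u →
      M₀ ≤ min (min (Oscillators.rho ω (x 0)) (Oscillators.rho ω (x T))) T →
      (Oscillators.rho ω (x 0) - Oscillators.rho ω (x T)) / T ≤ 1 + ε) := by
  constructor
  · intro ε hε
    -- The backward chaining needs a tolerance below `1`.
    have hδ : 0 < min ε (1 / 2) := by positivity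
    obtain ⟨L, hL, hupper⟩ := Oscillators.exists_rho_sub_le hpos hω hε
    obtain ⟨M, hlower⟩ := Oscillators.exists_le_rho_sub hpos hω hδ
      ((min_le_right _ _).trans_lt (by norm_num))
    refine ⟨max L M, fun T x u h hM => ?_⟩
    obtain ⟨⟨-, hMr⟩, hMT⟩ := (le_min_iff.1 hM).imp_left le_min_iff.1
    have hT : 0 < T := hL.trans_le ((le_max_left _ _).trans hMT)
    have h1 := hupper T x u h.toIsMotion ((le_max_left _ _).trans hMT)
    have h2 := hlower T x u h ((le_max_right _ _).trans hMr) ((le_max_right _ _).trans hMT)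
    have h3 : min ε (1 / 2) * T ≤ ε * T := by gcongr; exact min_le_left _ _
    rw [abs_le]
    constructor
    · rw [le_sub_iff_add_le, le_div_iff₀ hT]
      linarith
    · rw [sub_le_iff_le_add, div_le_iff₀ hT]
      linarith
  · intro ε hε
    obtain ⟨L, hL, hupper⟩ := Oscillators.exists_rho_sub_le hpos hω hε
    refine ⟨L, fun T x u h hM => ?_⟩
    have hMT := (le_min_iff.1 hM).2
    rw [div_le_iff₀ (hL.trans_le hMT)]
    exact hupper T x u h hMT
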